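/- Let $\lambda\in\mathbb C$, let $S=\mathbb C[w,x,y,z]$, put $$f = x^2+y^3+wz^2+w^3y-\lambda wy^2-\lambda w^4,\qquad R=S/(f),\qquad u=y-\lambda w,$$ and let $$\Psi=\begin{pmatrix}x&y&z&-w\\-uy&x&uw&z\\-wz&-w^2&x&-y\\uw^2&-wz&uy&x\end{pmatrix},\qquad \Phi=\begin{pmatrix}x&-y&-z&w\\uy&x&-uw&-z\\wz&w^2&x&y\\-uw^2&wz&-uy&x\end{pmatrix}.$$ Then $\Phi\Psi=\Psi\Phi=f\cdot\mathbf 1$. Let $M=\operatorname{coker}(\Psi: R^4\to R^4)$. Let $Q$ be the quiver with two vertices $R$ and $M$, one arrow $d:R\to M$, one arrow $c:M\to R$ and two loops $a,b$ at $M$, and let $\mathbb CQ$ be its path algebra, paths being composed from right to left. Let $I\subset\mathbb CQ$ be the two-sided ideal generated by $$(b^2+dc)d,\qquad c(b^2+dc),\qquad ab+ba,\qquad a^2+bdc+dcb+\lambda b^2+b^3 .$$ (i) These four elements are, in this order, the cyclic derivatives $\partial W/\partial c$, $\partial W/\partial d$, $\partial W/\partial a$, $\partial W/\partial b$ of the superpotential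 $$W=b^2dc+\tfrac12\,dcdc+a^2b+\tfrac{\lambda}{3}b^3+\tfrac14b^4$$ (an element of $\mathbb CQ$ modulo the linear span of commutators). Here the cyclic derivative with respect to an arrow $\alpha$ sends a closed path $p$ to the sum of $vu$ over all ways of writing $p=u\alpha v$. (ii) There is an isomorphism of $\mathbb C$-algebras $\mathbb CQ/I\cong\operatorname{End}_R(R\oplus M)$ which sends the trivial paths at the vertices $R$ and $M$ to the projections onto the summands $R$ and $M$, the arrow $d$ to the map $R\to M$ taking $1$ to the class of the fourth standard basis vector, the arrow $c$ to the map $M\to R$ induced by the first row $(x,-y,-z,w)$ of $\Phi$, and the loops $a$, $b$ to the endomorphisms of $M$ induced by the matrices $$\begin{pmatrix}0&1&0&0\\-u&0&0&0\\0&0&0&1\\0&0&-u&0\end{pmatrix},\qquad \begin{pmatrix}0&0&1&0\\0&0&0&-1\\-w&0&0&0\\0&w&0&0\end{pmatrix}$$ respectively. -/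

import Mathlib

/-!
Over `T = ℂ[w, y, z]` the module `M` is the quaternion order `H = T⟨1, i, j, k⟩` with `i² = -u` and
`j² = -w`: the loops `a`, `b` are the left multiplications by `i`, `j`, and `x ∈ R` is the right
multiplication by `ξ = y i + z j - w k`, whose square is the scalar `x²`. Hence `Hom(R, M)` is `H`,
`Hom(M, R)` is `H` through the map `c`, which has the shape of a nondegenerate trace form, and
`End(M) = H ⊕ H dc`. In the path algebra modulo the relations, the elements that act on `R ⊕ M` as
`w`, `y` and `z` turn out to be central, and over them every element has a normal form with exactly
the same five types of summands. The isomorphism matches the two sets of normal forms.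
-/

/-! ### Path algebras, cyclic words and cyclic derivatives -/

/-- All paths of a quiver, with their source and target; the trivial paths are included. -/
abbrev QuiverPaths (Q : Type) [Quiver.{0} Q] : Type :=
  Σ i : Q, Σ j : Q, Quiver.Path i j

/-- The path algebra of a quiver: the vector space with basis the set of all paths. -/
def PathAlgebra (k Q : Type) [Field k] [Quiver.{0} Q] : Type :=
  QuiverPaths Q →₀ k

namespace PathAlgebra

section

variable (k : Type) {Q : Type} [Field k] [Quiver.{0} Q]

noncomputable instance : AddCommGroup (PathAlgebra k Q) :=
  inferInstanceAs (AddCommGroup (QuiverPaths Q →₀ k))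

noncomputable instance : Module k (PathAlgebra k Q) :=
  inferInstanceAs (Module k (QuiverPaths Q →₀ k))

/-- The basis element given by a path. -/
noncomputable def ofPath {i j : Q} (p : Quiver.Path i j) : PathAlgebra k Q :=
  Finsupp.single (⟨i, j, p⟩ : QuiverPaths Q) (1 : k)

/-- The trivial path (of length zero) at a vertex. -/
noncomputable def vertex (i : Q) : PathAlgebra k Q :=
  ofPath k (Quiver.Path.nil : Quiver.Path i i)

/-- An arrow as an element of the path algebra. -/
noncomputable def arrow {i j : Q} (e : i ⟶ j) : PathAlgebra k Q :=
  ofPath k e.toPath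

/-- The linear map out of the path algebra with given values on paths. -/
noncomputable def lift {V : Type} [AddCommGroup V] [Module k V] (g : QuiverPaths Q → V) :
    PathAlgebra k Q →ₗ[k] V :=
  Finsupp.linearCombination k g

theorem lift_ofPath {V : Type} [AddCommGroup V] [Module k V] (g : QuiverPaths Q → V)
    {i j : Q} (p : Quiver.Path i j) : lift k g (ofPath k p) = g ⟨i, j, p⟩ :=
  (Finsupp.linearCombination_single k (1 : k) (⟨i, j, p⟩ : QuiverPaths Q)).trans (one_smul k _)

theorem hom_ext {V : Type} [AddCommGroup V] [Module k V] {g h : PathAlgebra k Q →ₗ[k] V}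
    (H : ∀ (i j : Q) (p : Quiver.Path i j), g (ofPath k p) = h (ofPath k p)) : g = h :=
  Finsupp.lhom_ext' fun ⟨i, j, p⟩ => LinearMap.ext_ring (H i j p)

theorem induction_paths {motive : PathAlgebra k Q → Prop} (x : PathAlgebra k Q)
    (zero : motive 0) (add : ∀ x y, motive x → motive y → motive (x + y))
    (smul : ∀ (r : k) (x), motive x → motive (r • x))
    (path : ∀ {i j : Q} (p : Quiver.Path i j), motive (ofPath k p)) : motive x := by
  refine Finsupp.induction_linear (motive := motive) x zero add ?_
  rintro ⟨i, j, p⟩ r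
  have h : (Finsupp.single (⟨i, j, p⟩ : QuiverPaths Q) r) =
      r • Finsupp.single (⟨i, j, p⟩ : QuiverPaths Q) (1 : k) := by
    rw [Finsupp.smul_single, smul_eq_mul, mul_one]
  rw [h]
  exact smul r _ (path p)

variable [DecidableEq Q]

/-- The product of two paths. Paths are composed from right to left, like maps: `q * p` is
"first `p`, then `q`" if `p` ends where `q` starts, and `0` otherwise. -/
noncomputable def pathMul (q p : QuiverPaths Q) : PathAlgebra k Q :=
  if h : p.2.1 = q.1 then ofPath k (p.2.2.comp (q.2.2.cast h.symm rfl)) else 0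

noncomputable def mulHom : PathAlgebra k Q →ₗ[k] PathAlgebra k Q →ₗ[k] PathAlgebra k Q :=
  lift k fun q => lift k fun p => pathMul k q p

noncomputable instance : Mul (PathAlgebra k Q) := ⟨fun x y => mulHom k x y⟩

theorem mul_def (x y : PathAlgebra k Q) : x * y = mulHom k x y := rfl

theorem ofPath_mul_ofPath {i j l : Q} (q : Quiver.Path j l) (p : Quiver.Path i j) :
    ofPath k q * ofPath k p = ofPath k (p.comp q) := by
  simp [mul_def, mulHom, lift_ofPath, pathMul]

theorem ofPath_mul_ofPath_of_ne {i j j' l : Q} (q : Quiver.Path j' l) (p : Quiver.Path i j)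
    (h : j ≠ j') : ofPath k q * ofPath k p = 0 := by
  simp [mul_def, mulHom, lift_ofPath, pathMul, h]

theorem vertex_mul_ofPath {i j l : Q} (p : Quiver.Path i j) :
    vertex k l * ofPath k p = if j = l then ofPath k p else 0 := by
  split_ifs with h
  · subst h; simp [vertex, ofPath_mul_ofPath]
  · exact ofPath_mul_ofPath_of_ne k _ _ h

theorem ofPath_mul_vertex {i j l : Q} (p : Quiver.Path i j) :
    ofPath k p * vertex k l = if l = i then ofPath k p else 0 := by
  split_ifs with h
  · subst h; simp [vertex, ofPath_mul_ofPath]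
  · exact ofPath_mul_ofPath_of_ne k _ _ h

protected theorem mul_assoc (x y z : PathAlgebra k Q) : x * y * z = x * (y * z) := by
  induction x using induction_paths with
  | zero => simp [mul_def]
  | add x x' hx hx' => simp only [mul_def, map_add, LinearMap.add_apply] at *; rw [hx, hx']
  | smul r x hx => simp only [mul_def, map_smul, LinearMap.smul_apply] at *; rw [hx]
  | path x =>
  induction y using induction_paths with
  | zero => simp [mul_def]
  | add x x' hx hx' => simp only [mul_def, map_add, LinearMap.add_apply] at *; rw [hx, hx']
  | smul r x hx => simp only [mul_def, map_smul, LinearMap.smul_apply] at *; rw [hx]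
  | path y =>
  induction z using induction_paths with
  | zero => simp [mul_def]
  | add x x' hx hx' => simp only [mul_def, map_add] at *; rw [hx, hx']
  | smul r x hx => simp only [mul_def, map_smul] at *; rw [hx]
  | path z =>
  rename_i i₁ j₁ i₂ j₂ i₃ j₃
  by_cases h₁ : j₂ = i₁
  · subst h₁
    by_cases h₂ : j₃ = i₂
    · subst h₂
      simp [ofPath_mul_ofPath]
    · rw [ofPath_mul_ofPath, ofPath_mul_ofPath_of_ne k _ _ h₂, ofPath_mul_ofPath_of_ne k _ _ h₂]
      simp [mul_def]
  · by_cases h₂ : j₃ = i₂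
    · subst h₂
      rw [ofPath_mul_ofPath, ofPath_mul_ofPath_of_ne k _ _ h₁, ofPath_mul_ofPath_of_ne k _ _ h₁]
      simp [mul_def]
    · rw [ofPath_mul_ofPath_of_ne k _ _ h₁, ofPath_mul_ofPath_of_ne k _ _ h₂]
      simp [mul_def]

variable [Fintype Q]

/-- The unit is the sum of the trivial paths. -/
noncomputable instance : One (PathAlgebra k Q) := ⟨∑ i : Q, vertex k i⟩

protected theorem one_mul (x : PathAlgebra k Q) : 1 * x = x := by
  have : mulHom k (1 : PathAlgebra k Q) = LinearMap.id := by
    apply hom_ext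
    intro i j p
    rw [show (1 : PathAlgebra k Q) = ∑ i : Q, vertex k i from rfl, map_sum]
    simp only [LinearMap.sum_apply, ← mul_def, vertex_mul_ofPath]
    simp
  exact congrArg (fun g => g x) this

protected theorem mul_one (x : PathAlgebra k Q) : x * 1 = x := by
  have : (mulHom k).flip (1 : PathAlgebra k Q) = LinearMap.id := by
    apply hom_ext
    intro i j p
    rw [LinearMap.flip_apply, show (1 : PathAlgebra k Q) = ∑ i : Q, vertex k i from rfl, map_sum]
    simp only [← mul_def, ofPath_mul_vertex]
    simp
  exact congrArg (fun g => g x) this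

noncomputable instance : Ring (PathAlgebra k Q) where
  __ := (inferInstance : AddCommGroup (PathAlgebra k Q))
  mul_assoc := PathAlgebra.mul_assoc k
  one_mul := PathAlgebra.one_mul k
  mul_one := PathAlgebra.mul_one k
  zero_mul x := by simp [mul_def]
  mul_zero x := by simp [mul_def]
  left_distrib x y z := by simp [mul_def]
  right_distrib x y z := by simp [mul_def]

noncomputable instance : Algebra k (PathAlgebra k Q) :=
  Algebra.ofModule (fun r x y => by simp [mul_def]) (fun r x y => by simp [mul_def])

/-- The space of cyclic words: the path algebra modulo the linear span of all commutators.
Paths that are not closed vanish here, and closed paths are identified with their cyclic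
rotations. -/
abbrev Cyc (k Q : Type) [Field k] [Quiver.{0} Q] [DecidableEq Q] [Fintype Q] : Type :=
  PathAlgebra k Q ⧸
    Submodule.span k {v : PathAlgebra k Q | ∃ x y : PathAlgebra k Q, v = x * y - y * x}

/-- The class of an element of the path algebra in the space of cyclic words. -/
noncomputable def toCyc : PathAlgebra k Q →ₗ[k] Cyc k Q :=
  Submodule.mkQ _

open Classical in
/-- For an arrow `α` and a path `p`, the sum of `v * s * u` over all ways to write `p` as
`u * α * v`. -/
noncomputable def pathDeriv {i j : Q} (α : i ⟶ j) {l : Q} :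
    {m : Q} → Quiver.Path l m → PathAlgebra k Q → PathAlgebra k Q
  | _, .nil, _ => 0
  | _, .cons (b := b) (c := c) p e, s =>
    (if (⟨b, c, e⟩ : Σ b : Q, Σ c : Q, b ⟶ c) = ⟨i, j, α⟩ then ofPath k p * s else 0) +
      pathDeriv α p (s * arrow k e)

/-- The cyclic derivative on the path algebra: a closed path `p` at `m` goes to the sum of
`v * u` over all ways to write `p = u * α * v`; a path which is not closed goes to zero. -/
noncomputable def cycDerivLift {i j : Q} (α : i ⟶ j) : PathAlgebra k Q →ₗ[k] PathAlgebra k Q :=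
  lift k fun p => pathDeriv k α p.2.2 (vertex k p.2.1 * vertex k p.1)

theorem pathDeriv_zero {i j : Q} (α : i ⟶ j) {l m : Q} (p : Quiver.Path l m) :
    pathDeriv k α p 0 = 0 := by
  induction p with
  | nil => rfl
  | cons p e ih => simp [pathDeriv, ih]

theorem pathDeriv_comp {i j : Q} (α : i ⟶ j) {l m n : Q} (p : Quiver.Path l m)
    (q : Quiver.Path m n) (s : PathAlgebra k Q) (hs : s * vertex k n = s) :
    pathDeriv k α (p.comp q) s =
      pathDeriv k α q (ofPath k p * s) + pathDeriv k α p (s * ofPath k q) := by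
  induction q generalizing s with
  | nil =>
    change pathDeriv k α p s = 0 + pathDeriv k α p (s * vertex k m)
    rw [hs, zero_add]
  | cons q e ih =>
    have h₁ : ofPath k (q.cons e) = arrow k e * ofPath k q :=
      (ofPath_mul_ofPath k e.toPath q).symm
    have h₂ := ih (s * arrow k e) (by
      rw [mul_assoc, arrow, ofPath_mul_vertex, if_pos rfl])
    rw [Quiver.Path.comp_cons, pathDeriv, pathDeriv, h₂, h₁, ← ofPath_mul_ofPath]
    simp only [mul_assoc, add_assoc]

theorem cycDerivLift_ofPath {i j : Q} (α : i ⟶ j) {l m : Q} (p : Quiver.Path l m) :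
    cycDerivLift k α (ofPath k p) = pathDeriv k α p (vertex k m * vertex k l) :=
  lift_ofPath k _ p

theorem cycDerivLift_of_ne {i j : Q} (α : i ⟶ j) {l m : Q} (p : Quiver.Path l m) (h : l ≠ m) :
    cycDerivLift k α (ofPath k p) = 0 := by
  rw [cycDerivLift_ofPath, vertex, vertex, ofPath_mul_ofPath_of_ne k _ _ h, pathDeriv_zero]

theorem cycDerivLift_comp {i j : Q} (α : i ⟶ j) {l m : Q} (p : Quiver.Path l m)
    (q : Quiver.Path m l) :
    cycDerivLift k α (ofPath k (p.comp q)) =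
      pathDeriv k α q (ofPath k p) + pathDeriv k α p (ofPath k q) := by
  have h : vertex k l * vertex k l = vertex k l := by
    simp [vertex, ofPath_mul_ofPath]
  rw [cycDerivLift_ofPath, h, pathDeriv_comp k α p q _ h, ofPath_mul_vertex, if_pos rfl,
    vertex_mul_ofPath, if_pos rfl]

theorem cycDerivLift_mul_comm {i j : Q} (α : i ⟶ j) (x y : PathAlgebra k Q) :
    cycDerivLift k α (x * y) = cycDerivLift k α (y * x) := by
  induction x using induction_paths with
  | zero => simp
  | add x x' hx hx' => simp only [add_mul, mul_add, map_add, hx, hx']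
  | smul r x hx => simp only [smul_mul_assoc, mul_smul_comm, map_smul, hx]
  | path q =>
  induction y using induction_paths with
  | zero => simp
  | add x x' hx hx' => simp only [add_mul, mul_add, map_add, hx, hx']
  | smul r x hx => simp only [smul_mul_assoc, mul_smul_comm, map_smul, hx]
  | path p =>
  rename_i a b c d
  by_cases h₁ : d = a
  · subst h₁
    by_cases h₂ : b = c
    · subst h₂
      rw [ofPath_mul_ofPath, ofPath_mul_ofPath, cycDerivLift_comp, cycDerivLift_comp, add_comm]
    · rw [ofPath_mul_ofPath, ofPath_mul_ofPath_of_ne k _ _ h₂,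
        cycDerivLift_of_ne k _ _ (Ne.symm h₂), map_zero]
  · by_cases h₂ : b = c
    · subst h₂
      rw [ofPath_mul_ofPath, ofPath_mul_ofPath_of_ne k _ _ h₁,
        cycDerivLift_of_ne k _ _ (Ne.symm h₁), map_zero]
    · rw [ofPath_mul_ofPath_of_ne k _ _ h₁, ofPath_mul_ofPath_of_ne k _ _ h₂]

/-- The cyclic derivative `∂/∂α` with respect to an arrow `α`, on the space of cyclic words. -/
noncomputable def cycDeriv {i j : Q} (α : i ⟶ j) : Cyc k Q →ₗ[k] PathAlgebra k Q :=
  Submodule.liftQ _ (cycDerivLift k α) (by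
    rw [Submodule.span_le]
    rintro _ ⟨x, y, rfl⟩
    simp [cycDerivLift_mul_comm k α x y])

end

end PathAlgebra

/-! ### The hypersurface, the matrix factorization and the module -/

namespace MorrisonPinkham

open MvPolynomial

/-- The polynomial ring `ℂ[w, x, y, z]`, with the variables in this order. -/
abbrev S : Type := MvPolynomial (Fin 4) ℂ

noncomputable abbrev w : S := X 0
noncomputable abbrev x : S := X 1
noncomputable abbrev y : S := X 2
noncomputable abbrev z : S := X 3

/-- `f = x² + y³ + w z² + w³ y - λ w y² - λ w⁴`. -/
noncomputable def f (lam : ℂ) : S :=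
  x ^ 2 + y ^ 3 + w * z ^ 2 + w ^ 3 * y - C lam * w * y ^ 2 - C lam * w ^ 4

/-- The coordinate ring `R = ℂ[w, x, y, z] / (f)`. -/
abbrev R (lam : ℂ) : Type := S ⧸ Ideal.span {f lam}

/-- The abbreviation `u = y - λ w`. -/
noncomputable abbrev u (lam : ℂ) : S := y - C lam * w

noncomputable def Psi (lam : ℂ) : Matrix (Fin 4) (Fin 4) S :=
  !![x, y, z, -w;
     -(u lam * y), x, u lam * w, z;
     -(w * z), -w ^ 2, x, -y;
     u lam * w ^ 2, -(w * z), u lam * y, x]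

noncomputable def Phi (lam : ℂ) : Matrix (Fin 4) (Fin 4) S :=
  !![x, -y, -z, w;
     u lam * y, x, -(u lam * w), -z;
     w * z, w ^ 2, x, y;
     -(u lam * w ^ 2), w * z, -(u lam * y), x]

/-- The matrices of the endomorphisms `a` and `b` of `coker Ψ`. -/
noncomputable def matA (lam : ℂ) : Matrix (Fin 4) (Fin 4) S :=
  !![0, 1, 0, 0;
     -u lam, 0, 0, 0;
     0, 0, 0, 1;
     0, 0, -u lam, 0]

noncomputable def matB : Matrix (Fin 4) (Fin 4) S :=
  !![0, 0, 1, 0;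
     0, 0, 0, -1;
     -w, 0, 0, 0;
     0, w, 0, 0]

/-- The `R`-linear map `Rⁿ → Rᵐ` (on column vectors) given by a matrix with entries in `S`. -/
noncomputable def matMap (lam : ℂ) {m n : ℕ} (A : Matrix (Fin m) (Fin n) S) :
    (Fin n → R lam) →ₗ[R lam] (Fin m → R lam) :=
  (A.map (Ideal.Quotient.mk (Ideal.span {f lam}))).mulVecLin

theorem matMap_mul (lam : ℂ) {l m n : ℕ} (A : Matrix (Fin l) (Fin m) S)
    (B : Matrix (Fin m) (Fin n) S) : matMap lam (A * B) = matMap lam A ∘ₗ matMap lam B := by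
  rw [matMap, Matrix.map_mul, Matrix.mulVecLin_mul]
  rfl

/-- The module `M = coker Ψ`. -/
abbrev M (lam : ℂ) : Type := (Fin 4 → R lam) ⧸ LinearMap.range (matMap lam (Psi lam))

/-- A square matrix that commutes with `Ψ` induces an endomorphism of `M = coker Ψ`. -/
noncomputable def cokerEnd (lam : ℂ) (A : Matrix (Fin 4) (Fin 4) S)
    (h : A * Psi lam = Psi lam * A) : M lam →ₗ[R lam] M lam :=
  Submodule.mapQ _ _ (matMap lam A) (by
    rintro _ ⟨v, rfl⟩
    refine ⟨matMap lam A v, ?_⟩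
    rw [← LinearMap.comp_apply, ← LinearMap.comp_apply, ← matMap_mul, ← matMap_mul, h])

theorem matA_mul_Psi (lam : ℂ) : matA lam * Psi lam = Psi lam * matA lam := by
  refine Matrix.ext fun i j => ?_
  fin_cases i <;> fin_cases j <;>
    simp [matA, Psi, Matrix.mul_apply, Fin.sum_univ_four] <;> ring

theorem matB_mul_Psi (lam : ℂ) : matB * Psi lam = Psi lam * matB := by
  refine Matrix.ext fun i j => ?_
  fin_cases i <;> fin_cases j <;>
    simp [matB, Psi, Matrix.mul_apply, Fin.sum_univ_four] <;> ring

noncomputable def loopA (lam : ℂ) : M lam →ₗ[R lam] M lam :=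
  cokerEnd lam (matA lam) (matA_mul_Psi lam)

noncomputable def loopB (lam : ℂ) : M lam →ₗ[R lam] M lam :=
  cokerEnd lam matB (matB_mul_Psi lam)

/-- The first row `(x, -y, -z, w)` of `Φ`, as a linear map `R⁴ → R`. -/
noncomputable def rowC (lam : ℂ) : (Fin 4 → R lam) →ₗ[R lam] R lam :=
  LinearMap.proj 0 ∘ₗ matMap lam (Phi lam)

theorem Phi_mul_Psi_row (lam : ℂ) (j : Fin 4) :
    (Phi lam * Psi lam) 0 j = if j = 0 then f lam else 0 := by
  fin_cases j <;> simp [Phi, Psi, f, Matrix.mul_apply, Fin.sum_univ_four] <;> ring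

/-- The map `c : M → R` induced by the first row of `Φ`. -/
noncomputable def mapC (lam : ℂ) : M lam →ₗ[R lam] R lam :=
  Submodule.liftQ _ (rowC lam) (by
    rintro _ ⟨v, rfl⟩
    change (matMap lam (Phi lam) ∘ₗ matMap lam (Psi lam)) v 0 = 0
    rw [← matMap_mul]
    simp only [matMap, Matrix.mulVecLin_apply, Matrix.mulVec, dotProduct,
      Matrix.map_apply, Phi_mul_Psi_row]
    refine Finset.sum_eq_zero fun j _ => ?_
    split_ifs
    · rw [Ideal.Quotient.eq_zero_iff_mem.mpr (Ideal.mem_span_singleton_self _), zero_mul]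
    · rw [map_zero, zero_mul])

/-- The map `d : R → M` that sends `1` to the class of the fourth standard basis vector. -/
noncomputable def mapD (lam : ℂ) : R lam →ₗ[R lam] M lam :=
  LinearMap.toSpanSingleton (R lam) (M lam) (Submodule.Quotient.mk (Pi.single 3 1))

/-- `End_R(R ⊕ M)`. -/
abbrev EndRM (lam : ℂ) : Type := Module.End (R lam) (R lam × M lam)

/-- A homomorphism between summands of `R ⊕ M`, extended by zero to an element of
`End_R(R ⊕ M)`. -/
noncomputable def extRR (lam : ℂ) (g : R lam →ₗ[R lam] R lam) : EndRM lam :=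
  LinearMap.inl _ _ _ ∘ₗ g ∘ₗ LinearMap.fst _ _ _

noncomputable def extRM (lam : ℂ) (g : R lam →ₗ[R lam] M lam) : EndRM lam :=
  LinearMap.inr _ _ _ ∘ₗ g ∘ₗ LinearMap.fst _ _ _

noncomputable def extMR (lam : ℂ) (g : M lam →ₗ[R lam] R lam) : EndRM lam :=
  LinearMap.inl _ _ _ ∘ₗ g ∘ₗ LinearMap.snd _ _ _

noncomputable def extMM (lam : ℂ) (g : M lam →ₗ[R lam] M lam) : EndRM lam :=
  LinearMap.inr _ _ _ ∘ₗ g ∘ₗ LinearMap.snd _ _ _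

/-! ### The quiver, its relations and the superpotential -/

/-- The two vertices of the quiver. -/
inductive Vertex : Type
  | nodeR
  | nodeM
  deriving DecidableEq

instance : Fintype Vertex := ⟨{.nodeR, .nodeM}, fun v => by cases v <;> simp⟩

/-- The arrows `d : R → M`, `c : M → R` and the loops `a`, `b` at `M`. -/
inductive Arrow : Vertex → Vertex → Type
  | d : Arrow .nodeR .nodeM
  | c : Arrow .nodeM .nodeR
  | a : Arrow .nodeM .nodeM
  | b : Arrow .nodeM .nodeM

instance : Quiver Vertex := ⟨Arrow⟩

abbrev arrD : Vertex.nodeR ⟶ Vertex.nodeM := Arrow.d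
abbrev arrC : Vertex.nodeM ⟶ Vertex.nodeR := Arrow.c
abbrev arrA : Vertex.nodeM ⟶ Vertex.nodeM := Arrow.a
abbrev arrB : Vertex.nodeM ⟶ Vertex.nodeM := Arrow.b

/-- The path algebra of the quiver, without relations. -/
abbrev P : Type := PathAlgebra ℂ Vertex

noncomputable def eR : P := PathAlgebra.vertex ℂ Vertex.nodeR
noncomputable def eM : P := PathAlgebra.vertex ℂ Vertex.nodeM
noncomputable def a : P := PathAlgebra.arrow ℂ arrA
noncomputable def b : P := PathAlgebra.arrow ℂ arrB
noncomputable def c : P := PathAlgebra.arrow ℂ arrC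
noncomputable def d : P := PathAlgebra.arrow ℂ arrD

/-- The two-sided ideal of the path algebra generated by the four relations. -/
noncomputable def relIdeal (lam : ℂ) : TwoSidedIdeal P :=
  TwoSidedIdeal.span
    {(b ^ 2 + d * c) * d,
     c * (b ^ 2 + d * c),
     a * b + b * a,
     a ^ 2 + b * d * c + d * c * b + lam • b ^ 2 + b ^ 3}

/-- The path algebra of the quiver with relations. -/
abbrev A (lam : ℂ) : Type := (relIdeal lam).ringCon.Quotient

/-- The class of an element of the path algebra modulo the relations. -/
noncomputable def toA (lam : ℂ) (p : P) : A lam := (p : (relIdeal lam).ringCon.Quotient)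

/-- The superpotential
`W = b² d c + (1/2) d c d c + a² b + (λ/3) b³ + (1/4) b⁴`, as a cyclic word. -/
noncomputable def W (lam : ℂ) : PathAlgebra.Cyc ℂ Vertex :=
  PathAlgebra.toCyc ℂ
    (b ^ 2 * d * c + (1 / 2 : ℂ) • (d * c * d * c) + a ^ 2 * b + (lam / 3) • b ^ 3 +
      (1 / 4 : ℂ) • b ^ 4)

end MorrisonPinkham

namespace PathAlgebra

section

variable {k Q B : Type} [Field k] [Quiver.{0} Q] [Ring B] [Algebra k B]

/-- The product of the images `g` of the arrows along a path; the trivial path at `i` goes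
to `e i`. -/
def evalPath (e : Q → B) (g : ∀ {i j : Q}, (i ⟶ j) → B) {i : Q} :
    {j : Q} → Quiver.Path i j → B
  | _, .nil => e i
  | _, .cons p α => g α * evalPath e g p

variable {e : Q → B} {g : ∀ {i j : Q}, (i ⟶ j) → B}

theorem evalPath_mul_idem (he : ∀ i, IsIdempotentElem (e i)) {i j : Q} (p : Quiver.Path i j) :
    evalPath e g p * e i = evalPath e g p := by
  induction p with
  | nil => exact he i
  | cons p α ih => rw [evalPath, mul_assoc, ih]

theorem idem_mul_evalPath (he : ∀ i, IsIdempotentElem (e i))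
    (hg : ∀ {i j : Q} (α : i ⟶ j), e j * g α = g α) {i j : Q} (p : Quiver.Path i j) :
    e j * evalPath e g p = evalPath e g p := by
  cases p with
  | nil => exact he i
  | cons p α => rw [evalPath, ← mul_assoc, hg]

theorem evalPath_comp (he : ∀ i, IsIdempotentElem (e i))
    (hg : ∀ {i j : Q} (α : i ⟶ j), e j * g α = g α)
    {i j l : Q} (p : Quiver.Path i j) (q : Quiver.Path j l) :
    evalPath e g (p.comp q) = evalPath e g q * evalPath e g p := by
  induction q with
  | nil => exact (idem_mul_evalPath he hg p).symm
  | cons q α ih => rw [Quiver.Path.comp_cons, evalPath, evalPath, ih, mul_assoc]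

variable [DecidableEq Q]

variable (k) in
theorem vertex_mul_vertex (i : Q) : vertex k i * vertex k i = vertex k i :=
  ofPath_mul_ofPath k _ _

variable (k) in
theorem vertex_mul_arrow {i j : Q} (α : i ⟶ j) : vertex k j * arrow k α = arrow k α := by
  rw [arrow, vertex_mul_ofPath, if_pos rfl]

variable (k) in
theorem arrow_mul_vertex {i j : Q} (α : i ⟶ j) : arrow k α * vertex k i = arrow k α := by
  rw [arrow, ofPath_mul_vertex, if_pos rfl]

variable [Fintype Q]

/-- The algebra homomorphism out of the path algebra given by a complete system of orthogonal
idempotents and compatible images of the arrows: the universal property of the path algebra. -/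
noncomputable def liftAlgHom (he : CompleteOrthogonalIdempotents e)
    (hg : ∀ {i j : Q} (α : i ⟶ j), e j * g α = g α) : PathAlgebra k Q →ₐ[k] B :=
  AlgHom.ofLinearMap (lift k fun p => evalPath e g p.2.2)
    (by
      rw [show (1 : PathAlgebra k Q) = ∑ i : Q, vertex k i from rfl, map_sum, ← he.complete]
      exact Finset.sum_congr rfl fun i _ => lift_ofPath k _ _)
    (by
      intro x y
      induction x using induction_paths with
      | zero => simp only [zero_mul, map_zero]
      | add x x' hx hx' => simp only [add_mul, map_add, hx, hx']
      | smul r x hx => simp only [smul_mul_assoc, map_smul, hx]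
      | path q =>
      induction y using induction_paths with
      | zero => simp only [mul_zero, map_zero]
      | add x x' hx hx' => simp only [mul_add, map_add, hx, hx']
      | smul r x hx => simp only [mul_smul_comm, map_smul, hx]
      | path p =>
      rename_i i₁ j₁ i₂ j₂
      by_cases h : j₂ = i₁
      · subst h
        rw [ofPath_mul_ofPath, lift_ofPath, lift_ofPath, lift_ofPath]
        exact evalPath_comp he.idem hg p q
      · rw [ofPath_mul_ofPath_of_ne k _ _ h, map_zero, lift_ofPath, lift_ofPath]
        change 0 = evalPath e g q * evalPath e g p
        rw [← evalPath_mul_idem he.idem q, ← idem_mul_evalPath he.idem hg p, mul_assoc,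
          ← mul_assoc (e i₁), he.ortho (Ne.symm h), zero_mul, mul_zero])

theorem liftAlgHom_vertex (he : CompleteOrthogonalIdempotents e)
    (hg : ∀ {i j : Q} (α : i ⟶ j), e j * g α = g α) (i : Q) :
    liftAlgHom he hg (vertex k i) = e i :=
  lift_ofPath k _ _

theorem liftAlgHom_arrow (he : CompleteOrthogonalIdempotents e)
    (hg : ∀ {i j : Q} (α : i ⟶ j), e j * g α = g α) {i j : Q} (α : i ⟶ j)
    (hα : g α * e i = g α) : liftAlgHom he hg (arrow k α) = g α :=
  (lift_ofPath k _ _).trans hα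

theorem eq_top_of_vertex_mem_of_arrow_mem {U : Subalgebra k (PathAlgebra k Q)}
    (hv : ∀ i, vertex k i ∈ U) (ha : ∀ {i j : Q} (α : i ⟶ j), arrow k α ∈ U) : U = ⊤ := by
  refine Algebra.eq_top_iff.mpr fun x => ?_
  induction x using induction_paths with
  | zero => exact U.zero_mem
  | add x y hx hy => exact U.add_mem hx hy
  | smul r x hx => exact U.smul_mem hx r
  | path p =>
    induction p with
    | nil => exact hv _
    | cons p α ih =>
      have := U.mul_mem (ha α) ih
      rwa [arrow, ofPath_mul_ofPath] at this

end

end PathAlgebra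

namespace MorrisonPinkham

theorem Phi_mul_Psi (lam : ℂ) :
    Phi lam * Psi lam = f lam • (1 : Matrix (Fin 4) (Fin 4) S) := by
  refine Matrix.ext fun i j => ?_
  fin_cases i <;> fin_cases j <;>
    simp [Phi, Psi, f, Matrix.mul_apply, Fin.sum_univ_four] <;> ring

theorem Psi_mul_Phi (lam : ℂ) :
    Psi lam * Phi lam = f lam • (1 : Matrix (Fin 4) (Fin 4) S) := by
  refine Matrix.ext fun i j => ?_
  fin_cases i <;> fin_cases j <;>
    simp [Phi, Psi, f, Matrix.mul_apply, Fin.sum_univ_four] <;> ring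

theorem toA_eq_zero (lam : ℂ) {p : P} (h : p ∈ relIdeal lam) : toA lam p = 0 :=
  (RingCon.eq _).mpr h

section

open PathAlgebra

theorem cycDeriv_W (lam : ℂ) :
    cycDeriv ℂ arrC (W lam) = (b ^ 2 + d * c) * d ∧
      cycDeriv ℂ arrD (W lam) = c * (b ^ 2 + d * c) ∧
      cycDeriv ℂ arrA (W lam) = a * b + b * a ∧
      cycDeriv ℂ arrB (W lam) = a ^ 2 + b * d * c + d * c * b + lam • b ^ 2 + b ^ 3 := by
  have cycDeriv_toCyc {i j : Vertex} (α : i ⟶ j) (p : P) :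
      cycDeriv ℂ α (toCyc ℂ p) = cycDerivLift ℂ α p := rfl
  simp only [W, cycDeriv_toCyc, map_add, map_smul, pow_succ, pow_zero, one_mul, mul_add, add_mul,
    a, b, c, d, arrow, ofPath_mul_ofPath, cycDerivLift_ofPath, vertex_mul_vertex, pathDeriv,
    Quiver.Hom.toPath, Quiver.Path.comp_cons, Quiver.Path.comp_nil, arrA, arrB, arrC, arrD]
  simp only [vertex, ofPath_mul_ofPath, Quiver.Path.comp_cons, Quiver.Path.comp_nil]
  simp only [Sigma.mk.injEq, heq_eq_eq, reduceCtorEq, false_and, and_false, ↓reduceIte, add_zero,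
    zero_add]
  refine ⟨?_, ?_, ?_, ?_⟩ <;> module

end

end MorrisonPinkham

/-- The quaternion order over `T` with `i² = -u`, `j² = -w` and `k = i j`. Over
`T = ℂ[w, y, z]` its underlying module is `M`. -/
abbrev QuatOrder {T : Type*} [CommRing T] (u w : T) : Type _ :=
  QuaternionAlgebra T (-u) 0 (-w)

namespace QuatOrder

section

variable {T : Type*} [CommRing T] {u w : T}

/-- The quaternion unit `i`; multiplication by it from the left is the loop `a`. -/
@[simps] def i : QuatOrder u w := ⟨0, 1, 0, 0⟩

/-- The quaternion unit `j`; multiplication by it from the left is the loop `b`. -/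
@[simps] def j : QuatOrder u w := ⟨0, 0, 1, 0⟩

/-- The quaternion unit `k = i j`. -/
@[simps] def k : QuatOrder u w := ⟨0, 0, 0, 1⟩

theorem i_mul_i : (i * i : QuatOrder u w) = (-u) • 1 := by
  ext1 <;> simp

theorem j_mul_j : (j * j : QuatOrder u w) = (-w) • 1 := by
  ext1 <;> simp

theorem j_mul_i : (j * i : QuatOrder u w) = -(i * j) := by
  ext1 <;> simp

theorem eq_smul_one_add (h : QuatOrder u w) :
    h = h.re • 1 + h.imI • i + h.imJ • j + h.imK • k := by
  ext1 <;> simp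

theorem linearMap_ext {N : Type*} [AddCommMonoid N] [Module T N] {F G : QuatOrder u w →ₗ[T] N}
    (h_one : F 1 = G 1) (h_i : F i = G i) (h_j : F j = G j) (h_k : F k = G k) : F = G := by
  ext h
  rw [eq_smul_one_add h]
  simp only [map_add, map_smul, h_one, h_i, h_j, h_k]

variable (y z : T)

/-- The quaternion `ξ = y i + z j - w k`; multiplication by it from the right is the action
of `x` on `M`. -/
@[simps] def xi : QuatOrder u w := ⟨0, y, z, -w⟩

variable (u w) in
/-- The square of `ξ`, which is the square of `x` in the hypersurface ring. -/
def xiSq : T := -(u * y ^ 2 + w * z ^ 2 + u * w ^ 3)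

theorem xi_mul_xi : xi y z * xi y z = xiSq u w y z • (1 : QuatOrder u w) := by
  ext1 <;> simp [xiSq] <;> ring

variable (u w) in
/-- The quadratic extension `T[ω]` of `T` with `ω² = ξ²`. Over `T = ℂ[w, y, z]` it is the
hypersurface ring `R`, with `ω` in the place of `x`. -/
abbrev QuadOrder : Type _ := QuadraticAlgebra T (xiSq u w y z) 0

/-- The embedding `ω ↦ ξ` of the quadratic order. -/
def ofQuad : QuadOrder u w y z →ₐ[T] QuatOrder u w :=
  QuadraticAlgebra.lift ⟨xi y z, by rw [xi_mul_xi, zero_smul, add_zero]⟩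

variable {y z} in
theorem ofQuad_apply (r : QuadOrder u w y z) : ofQuad y z r = r.re • 1 + r.im • xi y z := by
  simp [ofQuad, QuadraticAlgebra.lift]

theorem ofQuad_omega : ofQuad (u := u) (w := w) y z QuadraticAlgebra.omega = xi y z := by
  simp [ofQuad_apply]

variable {y z} in
theorem map_mul_ofQuad_of_map_mul_xi {S N : Type*} [CommRing S] [Algebra T S] [AddCommGroup N]
    [Module T N] [Module S N] [IsScalarTower T S N] {ρ : QuadOrder u w y z →ₐ[T] S}
    {m : QuatOrder u w →ₗ[T] N} (hm : ∀ h, m (h * xi y z) = ρ QuadraticAlgebra.omega • m h)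
    (h : QuatOrder u w) (r : QuadOrder u w y z) : m (h * ofQuad y z r) = ρ r • m h := by
  have hr : r = r.re • 1 + r.im • QuadraticAlgebra.omega := by
    rw [← Algebra.algebraMap_eq_smul_one]
    exact QuadraticAlgebra.mk_eq_add_smul_omega r.re r.im
  conv_rhs => rw [hr]
  rw [ofQuad_apply, mul_add, mul_smul_comm, mul_smul_comm, mul_one, map_add, map_smul, map_smul,
    hm, map_add, map_smul, map_smul, map_one, add_smul, smul_assoc, smul_assoc, one_smul]

/-- The map `c : M → R`, in terms of quaternions. Its `ω`-component is the functional
`h ↦ -h.imK`, and its other component is determined by linearity over the quadratic order. -/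
def pairing : QuatOrder u w →ₗ[T] QuadOrder u w y z where
  toFun h := ⟨-(h * xi y z).imK, -h.imK⟩
  map_add' h h' := by ext <;> simp <;> ring
  map_smul' t h := by ext <;> simp; ring

variable {y z} in
theorem re_pairing (h : QuatOrder u w) :
    (pairing y z h).re = w * h.re - z * h.imI + y * h.imJ := by
  simp [pairing]
  ring

theorem im_pairing (h : QuatOrder u w) : (pairing y z h).im = -h.imK := rfl

variable {y z} in
theorem pairing_mul_ofQuad (h : QuatOrder u w) (r : QuadOrder u w y z) :
    pairing y z (h * ofQuad y z r) = r * pairing y z h := by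
  rw [ofQuad_apply]
  ext <;> simp [re_pairing, im_pairing, xiSq] <;> ring

/-- The endomorphism `d c` of `M`, in terms of quaternions. -/
def dc : QuatOrder u w →ₗ[T] QuatOrder u w :=
  (ofQuad y z).toLinearMap ∘ₗ pairing y z

theorem dc_apply (h : QuatOrder u w) :
    dc y z h = (w * h.re - z * h.imI + y * h.imJ) • 1 - h.imK • xi y z := by
  rw [dc, LinearMap.comp_apply, AlgHom.toLinearMap_apply, ofQuad_apply, re_pairing, im_pairing,
    neg_smul, ← sub_eq_add_neg]

/-- The automorphism `σ` in the commutation rule `d c ∘ h = σ h ∘ d c + δ h`. -/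
def twist (h : QuatOrder u w) : QuatOrder u w := ⟨h.re, -h.imI, -h.imJ, h.imK⟩

/-- The `σ`-derivation `δ` in the commutation rule `d c ∘ h = σ h ∘ d c + δ h`. -/
def skewDeriv (h : QuatOrder u w) : QuatOrder u w :=
  ⟨-z * h.imI + y * h.imJ, w * h.imI - y * h.imK, w * h.imJ - z * h.imK, 0⟩

theorem exists_eq_pairing_mul (g : QuatOrder u w →ₗ[T] QuadOrder u w y z)
    (hg : ∀ v, g (v * xi y z) = QuadraticAlgebra.omega * g v) :
    ∃ q, ∀ v, g v = pairing y z (q * v) := by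
  let q : QuatOrder u w := ⟨-(g k).im, -(g j).im, (g i).im, -(g 1).im⟩
  have him (v : QuatOrder u w) : (g v).im = -(q * v).imK := by
    conv_lhs => rw [eq_smul_one_add v]
    simp [q]
    ring
  refine ⟨q, fun v => ?_⟩
  ext
  · have : (g v).re = (QuadraticAlgebra.omega * g v).im := by simp
    rw [this, ← hg, him, ← mul_assoc]
    rfl
  · exact him v

variable {y z} in
theorem eq_zero_of_forall_pairing_mul {q : QuatOrder u w}
    (h : ∀ v, pairing y z (q * v) = 0) : q = 0 := by
  have him (v : QuatOrder u w) : (q * v).imK = 0 :=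
    neg_eq_zero.mp (congrArg QuadraticAlgebra.im (h v))
  ext
  · simpa using him k
  · simpa using him j
  · simpa using him i
  · simpa using him 1

theorem mul_smul_one_add_smul_i_mul (h : QuatOrder u w) (s t : T) :
    h * (s • 1 + t • i) * (s • 1 - t • i) = (s ^ 2 + t ^ 2 * u) • h := by
  ext1 <;> simp <;> ring

theorem mul_smul_one_sub_smul_i_mul (h : QuatOrder u w) (s t : T) :
    h * (s • 1 - t • i) * (s • 1 + t • i) = (s ^ 2 + t ^ 2 * u) • h := by
  ext1 <;> simp <;> ring

theorem mul_smul_one_sub_smul_j_mul (h : QuatOrder u w) (s t : T) :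
    h * (s • 1 - t • j) * (s • 1 + t • j) = (s ^ 2 + t ^ 2 * w) • h := by
  ext1 <;> simp <;> ring

theorem exists_eq_smul_of_smul_eq {n s : T} (hdvd : ∀ t, n ∣ s * t → n ∣ t)
    {p q : QuatOrder u w} (h : s • p = n • q) : ∃ v : QuatOrder u w, p = n • v := by
  obtain ⟨r₀, h₀⟩ := hdvd _ ⟨_, congrArg QuaternionAlgebra.re h⟩
  obtain ⟨r₁, h₁⟩ := hdvd _ ⟨_, congrArg QuaternionAlgebra.imI h⟩
  obtain ⟨r₂, h₂⟩ := hdvd _ ⟨_, congrArg QuaternionAlgebra.imJ h⟩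
  obtain ⟨r₃, h₃⟩ := hdvd _ ⟨_, congrArg QuaternionAlgebra.imK h⟩
  exact ⟨⟨r₀, r₁, r₂, r₃⟩, QuaternionAlgebra.ext h₀ h₁ h₂ h₃⟩

end

section

variable {T : Type*} [CommRing T] [IsDomain T] {u w y z : T}

theorem eq_zero_of_forall_mul_add_mul_dc (hn : z ^ 2 + w ^ 2 * u ≠ 0) {p q : QuatOrder u w}
    (h : ∀ v, p * v + q * dc y z v = 0) : p = 0 ∧ q = 0 := by
  have h_one : p + w • q = 0 := by
    simpa [dc_apply] using h 1
  have h_i : p * i - z • q = 0 := by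
    simpa [dc_apply, sub_eq_add_neg] using h i
  have hq : q * (z • 1 + w • i) = 0 :=
    calc q * (z • 1 + w • i) = (p + w • q) * i - (p * i - z • q) := by
          simp only [mul_add, add_mul, mul_smul_comm, smul_mul_assoc, mul_one]
          abel
      _ = 0 := by rw [h_one, h_i, zero_mul, sub_zero]
  have hq' : q = 0 := by
    have := mul_smul_one_add_smul_i_mul q z w
    rw [hq, zero_mul] at this
    exact (smul_eq_zero.mp this.symm).resolve_left hn
  exact ⟨by simpa [hq'] using h_one, hq'⟩

theorem exists_eq_mul_of_mul_mul_eq_neg_smul (hn : z ^ 2 + w ^ 2 * u ≠ 0)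
    (hdvd : ∀ t, z ^ 2 + w ^ 2 * u ∣ (y ^ 2 + w ^ 3) * t → z ^ 2 + w ^ 2 * u ∣ t)
    {p q : QuatOrder u w}
    (h : p * (z • 1 - w • i) * (y • 1 - w • j) = -((z ^ 2 + w ^ 2 * u) • q)) :
    ∃ v, p = v * (z • 1 + w • i) ∧ q = -(v * (y • 1 - w • j)) := by
  obtain ⟨v, hv⟩ : ∃ v, p * (z • 1 - w • i) = (z ^ 2 + w ^ 2 * u) • v := by
    refine exists_eq_smul_of_smul_eq hdvd (q := -(q * (y • 1 + w • j))) ?_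
    rw [show y ^ 2 + w ^ 3 = y ^ 2 + w ^ 2 * w by ring, ← mul_smul_one_sub_smul_j_mul, h,
      neg_mul, smul_mul_assoc, smul_neg]
  refine ⟨v, smul_right_injective _ hn ?_, smul_right_injective _ hn ?_⟩
  · change (z ^ 2 + w ^ 2 * u) • p = (z ^ 2 + w ^ 2 * u) • (v * _)
    rw [← mul_smul_one_sub_smul_i_mul, hv, smul_mul_assoc]
  · change (z ^ 2 + w ^ 2 * u) • q = (z ^ 2 + w ^ 2 * u) • -(v * _)
    rw [smul_neg, ← smul_mul_assoc, ← hv, h, neg_neg]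

theorem exists_eq_mul_dc_sub_of_map_one_eq_zero (hw : w ≠ 0) (hn : z ^ 2 + w ^ 2 * u ≠ 0)
    (hdvd : ∀ t, z ^ 2 + w ^ 2 * u ∣ (y ^ 2 + w ^ 3) * t → z ^ 2 + w ^ 2 * u ∣ t)
    {G : QuatOrder u w →ₗ[T] QuatOrder u w} (hG : ∀ v, G (v * xi y z) = G v * xi y z)
    (h_one : G 1 = 0) : ∃ q, ∀ v, G v = q * (dc y z v - w • v) := by
  have hsum (v : QuatOrder u w) : G v = v.imI • G i + v.imJ • G j + v.imK • G k := by
    conv_lhs => rw [eq_smul_one_add v]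
    simp only [map_add, map_smul, h_one, smul_zero, zero_add]
  have h_xi : w • G k = y • G i + z • G j := by
    have := hG 1
    rw [h_one, zero_mul, one_mul, hsum] at this
    linear_combination (norm := (simp only [imI_xi, imJ_xi, imK_xi]; module)) -this
  have h_i_xi : G i * xi y z = z • G k + (w * u) • G j := by
    rw [← hG, hsum]
    simp
    module
  obtain ⟨v, h_i, h_j⟩ : ∃ v, G i = v * (z • 1 + w • i) ∧ G j = -(v * (y • 1 - w • j)) := by
    refine exists_eq_mul_of_mul_mul_eq_neg_smul hn hdvd ?_
    have h_mul : (z • 1 - w • i) * (y • 1 - w • j) =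
        (z * y) • 1 - w • (xi y z : QuatOrder u w) := by
      ext1 <;> simp; ring
    rw [mul_assoc, h_mul, mul_sub, mul_smul_comm, mul_smul_comm, h_i_xi, mul_one]
    linear_combination (norm := module) -z • h_xi
  have h_k : G k = v * (y • i + z • j) := by
    refine smul_right_injective _ hw ?_
    change w • G k = w • _
    rw [h_xi, h_i, h_j]
    simp only [mul_add, mul_sub, mul_smul_comm, mul_one]
    module
  suffices G = LinearMap.mulLeft T (-v) ∘ₗ (dc y z - w • LinearMap.id) from
    ⟨-v, LinearMap.congr_fun this⟩
  refine linearMap_ext ?_ ?_ ?_ ?_ <;>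
    simp only [h_one, h_i, h_j, h_k, LinearMap.comp_apply, LinearMap.mulLeft_apply, neg_mul,
      LinearMap.sub_apply, LinearMap.smul_apply, LinearMap.id_apply, ← mul_neg, dc_apply]
  · simp
  · congr 1; ext1 <;> simp
  · congr 1; ext1 <;> simp
  · congr 1; ext1 <;> simp

theorem exists_eq_mul_add_mul_dc (hw : w ≠ 0) (hn : z ^ 2 + w ^ 2 * u ≠ 0)
    (hdvd : ∀ t, z ^ 2 + w ^ 2 * u ∣ (y ^ 2 + w ^ 3) * t → z ^ 2 + w ^ 2 * u ∣ t)
    {F : QuatOrder u w →ₗ[T] QuatOrder u w} (hF : ∀ v, F (v * xi y z) = F v * xi y z) :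
    ∃ p q, ∀ v, F v = p * v + q * dc y z v := by
  obtain ⟨q, hq⟩ := exists_eq_mul_dc_sub_of_map_one_eq_zero hw hn hdvd
    (G := F - LinearMap.mulLeft T (F 1)) (fun v => by simp [hF, sub_mul, mul_assoc]) (by simp)
  refine ⟨F 1 - w • q, q, fun v => ?_⟩
  have := hq v
  rw [LinearMap.sub_apply, LinearMap.mulLeft_apply, sub_eq_iff_eq_add] at this
  rw [this, mul_sub, sub_mul, mul_smul_comm, smul_mul_assoc]
  abel

end

end QuatOrder

/-- A representation, in a ring, of the quiver of the theorem: images of the two vertices and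
the four arrows, subject to the relations between them that hold in the path algebra. -/
@[ext] structure QuiverRep (B : Type*) [Ring B] where
  (eR eM a b c d : B)
  eR_add_eM : eR + eM = 1
  eR_mul_eR : eR * eR = eR
  a_mul_eR : a * eR = 0
  eR_mul_a : eR * a = 0
  b_mul_eR : b * eR = 0
  eR_mul_b : eR * b = 0
  c_mul_eR : c * eR = 0
  eR_mul_c : eR * c = c
  d_mul_eR : d * eR = d
  eR_mul_d : eR * d = 0

namespace QuiverRep

section

variable {B : Type*} [Ring B] (J : QuiverRep B)

/-- The image of a representation under a ring homomorphism. -/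
@[simps] def map {B' F : Type*} [Ring B'] [FunLike F B B'] [RingHomClass F B B'] (φ : F) :
    QuiverRep B' where
  eR := φ J.eR
  eM := φ J.eM
  a := φ J.a
  b := φ J.b
  c := φ J.c
  d := φ J.d
  eR_add_eM := by rw [← map_add, J.eR_add_eM, map_one]
  eR_mul_eR := by rw [← map_mul, J.eR_mul_eR]
  a_mul_eR := by rw [← map_mul, J.a_mul_eR, map_zero]
  eR_mul_a := by rw [← map_mul, J.eR_mul_a, map_zero]
  b_mul_eR := by rw [← map_mul, J.b_mul_eR, map_zero]
  eR_mul_b := by rw [← map_mul, J.eR_mul_b, map_zero]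
  c_mul_eR := by rw [← map_mul, J.c_mul_eR, map_zero]
  eR_mul_c := by rw [← map_mul, J.eR_mul_c]
  d_mul_eR := by rw [← map_mul, J.d_mul_eR]
  eR_mul_d := by rw [← map_mul, J.eR_mul_d, map_zero]

theorem eM_eq : J.eM = 1 - J.eR := eq_sub_of_add_eq' J.eR_add_eM

theorem a_mul_eM : J.a * J.eM = J.a := by rw [J.eM_eq, mul_sub, mul_one, J.a_mul_eR, sub_zero]

theorem b_mul_eM : J.b * J.eM = J.b := by rw [J.eM_eq, mul_sub, mul_one, J.b_mul_eR, sub_zero]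

theorem c_mul_eM : J.c * J.eM = J.c := by rw [J.eM_eq, mul_sub, mul_one, J.c_mul_eR, sub_zero]

theorem d_mul_eM : J.d * J.eM = 0 := by rw [J.eM_eq, mul_sub, mul_one, J.d_mul_eR, sub_self]

theorem eM_mul_a : J.eM * J.a = J.a := by
  rw [J.eM_eq, sub_mul, one_mul, J.eR_mul_a, sub_zero]

theorem eM_mul_b : J.eM * J.b = J.b := by rw [J.eM_eq, sub_mul, one_mul, J.eR_mul_b, sub_zero]

theorem eM_mul_d : J.eM * J.d = J.d := by rw [J.eM_eq, sub_mul, one_mul, J.eR_mul_d, sub_zero]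

theorem eR_mul_eM : J.eR * J.eM = 0 := by rw [J.eM_eq, mul_sub, mul_one, J.eR_mul_eR, sub_self]

theorem d_mul_a : J.d * J.a = 0 := by rw [← J.d_mul_eR, mul_assoc, J.eR_mul_a, mul_zero]

theorem d_mul_b : J.d * J.b = 0 := by rw [← J.d_mul_eR, mul_assoc, J.eR_mul_b, mul_zero]

theorem d_mul_d : J.d * J.d = 0 := by
  calc J.d * J.d = J.d * J.eR * J.d := by rw [J.d_mul_eR]
    _ = 0 := by rw [mul_assoc, J.eR_mul_d, mul_zero]

theorem a_mul_c : J.a * J.c = 0 := by rw [← J.eR_mul_c, ← mul_assoc, J.a_mul_eR, zero_mul]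

theorem b_mul_c : J.b * J.c = 0 := by rw [← J.eR_mul_c, ← mul_assoc, J.b_mul_eR, zero_mul]

theorem c_mul_c : J.c * J.c = 0 := by
  calc J.c * J.c = J.c * (J.eR * J.c) := by rw [J.eR_mul_c]
    _ = 0 := by rw [← mul_assoc, J.c_mul_eR, zero_mul]

/-- The image of a set of elements which, as `eM = 1 - eR`, generates the image of the path
algebra. -/
def generators : Set B := {J.eR, J.a, J.b, J.c, J.d}

theorem generators_map {B' F : Type*} [Ring B'] [FunLike F B B'] [RingHomClass F B B'] (φ : F) :
    (J.map φ).generators = φ '' J.generators := by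
  simp [generators, Set.image_insert_eq]

/-- The element that acts as `w` on `R ⊕ M`. -/
def centralW : B := J.c * J.d - J.b * J.b

/-- The element that acts as `y` on `R ⊕ M`. -/
def centralY : B :=
  J.c * J.b * J.d + J.b * J.d * J.c + J.d * J.c * J.b + J.b * J.b * J.b

/-- The element that acts as `z` on `R ⊕ M`. -/
def centralZ : B :=
  -(J.c * J.a * J.d + J.a * J.d * J.c + J.d * J.c * J.a + J.a * J.b * J.b)

section

variable {B' F : Type*} [Ring B'] [FunLike F B B'] [RingHomClass F B B'] (φ : F)

theorem map_centralW : (J.map φ).centralW = φ J.centralW := by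
  simp only [centralW, map_c, map_d, map_b, map_sub, map_mul]

theorem map_centralY : (J.map φ).centralY = φ J.centralY := by
  simp only [centralY, map_c, map_d, map_b, map_add, map_mul]

theorem map_centralZ : (J.map φ).centralZ = φ J.centralZ := by
  simp only [centralZ, map_c, map_d, map_a, map_b, map_neg, map_add, map_mul]

end

end

section

variable {k B : Type*} [CommRing k] [Ring B] [Algebra k B] (J : QuiverRep B) (lam : k)

variable {J} in
theorem adjoin_generators_map {B' : Type*} [Ring B'] [Algebra k B'] {φ : B →ₐ[k] B'}
    (hJ : Algebra.adjoin k J.generators = ⊤) (hφ : Function.Surjective φ) :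
    Algebra.adjoin k (J.map φ).generators = ⊤ := by
  rw [generators_map, ← AlgHom.map_adjoin, hJ, Algebra.map_top]
  exact φ.range_eq_top.mpr hφ

/-- The relations given by the cyclic derivatives of the superpotential. -/
structure IsPotential : Prop where
  b_mul_b_mul_d : J.b * J.b * J.d + J.d * J.c * J.d = 0
  c_mul_b_mul_b : J.c * J.b * J.b + J.c * J.d * J.c = 0
  a_mul_b : J.a * J.b + J.b * J.a = 0
  a_mul_a : J.a * J.a + J.b * J.d * J.c + J.d * J.c * J.b + algebraMap k B lam * J.b * J.b +
    J.b * J.b * J.b = 0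

variable {J lam}

theorem mem_center_of_forall_commute (hJ : Algebra.adjoin k J.generators = ⊤) {v : B}
    (hR : v * J.eR = J.eR * v) (ha : v * J.a = J.a * v) (hb : v * J.b = J.b * v)
    (hc : v * J.c = J.c * v) (hd : v * J.d = J.d * v) : v ∈ Subalgebra.center k B := by
  have hle : Algebra.adjoin k J.generators ≤ Subalgebra.centralizer k {v} := by
    refine Algebra.adjoin_le ?_
    rintro _ (rfl | rfl | rfl | rfl | rfl) _ rfl <;> assumption
  refine Subalgebra.mem_center_iff.mpr fun x => ?_
  exact (Subalgebra.mem_centralizer_iff k).mp (hle (hJ ▸ Algebra.mem_top)) v rfl |>.symm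

theorem centralW_mem_center (hJ : Algebra.adjoin k J.generators = ⊤) (h : J.IsPotential lam) :
    J.centralW ∈ Subalgebra.center k B := by
  apply mem_center_of_forall_commute hJ <;> rw [centralW]
  · linear_combination (norm := noncomm_ring) J.c * J.d_mul_eR - J.b * J.b_mul_eR -
      J.eR_mul_c * J.d + J.eR_mul_b * J.b
  · linear_combination (norm := noncomm_ring) J.c * J.d_mul_a - J.a_mul_c * J.d + h.a_mul_b * J.b -
      J.b * h.a_mul_b
  · linear_combination (norm := noncomm_ring) J.c * J.d_mul_b - J.b_mul_c * J.d
  · linear_combination (norm := noncomm_ring) h.c_mul_b_mul_b - J.b * J.b_mul_c - J.c_mul_c * J.d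
  · linear_combination (norm := noncomm_ring) J.c * J.d_mul_d - h.b_mul_b_mul_d + J.d_mul_b * J.b

theorem IsPotential.a_mul_b_mul_b (h : J.IsPotential lam) :
    J.a * J.b * J.b = J.b * J.b * J.a := by
  linear_combination (norm := noncomm_ring) h.a_mul_b * J.b - J.b * h.a_mul_b

theorem centralY_mem_center (hJ : Algebra.adjoin k J.generators = ⊤) (h : J.IsPotential lam) :
    J.centralY ∈ Subalgebra.center k B := by
  apply mem_center_of_forall_commute hJ <;> rw [centralY]
  · linear_combination (norm := noncomm_ring) J.c * J.b * J.d_mul_eR + J.b * J.d * J.c_mul_eR +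
      J.d * J.c * J.b_mul_eR + J.b * J.b * J.b_mul_eR - J.eR_mul_c * J.b * J.d -
      J.eR_mul_b * J.d * J.c - J.eR_mul_d * J.c * J.b - J.eR_mul_b * J.b * J.b
  · linear_combination (norm := noncomm_ring) J.c * J.b * J.d_mul_a - J.a_mul_c * J.b * J.d +
      h.a_mul_a * J.a - J.a * h.a_mul_a + algebraMap k B lam * h.a_mul_b_mul_b -
      Algebra.commutes lam J.a * J.b * J.b
  · linear_combination (norm := noncomm_ring) J.c * J.b * J.d_mul_b - J.b_mul_c * J.b * J.d +
      J.d * h.c_mul_b_mul_b - h.b_mul_b_mul_d * J.c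
  · linear_combination (norm := noncomm_ring) J.b * J.d * J.c_mul_c + J.d * J.c * J.b_mul_c +
      J.b * J.b * J.b_mul_c - J.c_mul_c * J.b * J.d - h.c_mul_b_mul_b * J.b
  · linear_combination (norm := noncomm_ring) J.c * J.b * J.d_mul_d + J.b * h.b_mul_b_mul_d -
      J.d_mul_b * J.d * J.c - J.d_mul_d * J.c * J.b - J.d_mul_b * J.b * J.b

theorem IsPotential.d_mul_c_mul_b_mul_b (h : J.IsPotential lam) :
    J.d * J.c * J.b * J.b = J.b * J.b * J.d * J.c := by
  linear_combination (norm := noncomm_ring) J.d * h.c_mul_b_mul_b - h.b_mul_b_mul_d * J.c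

theorem IsPotential.d_mul_c_mul_a_mul_a (h : J.IsPotential lam) :
    J.d * J.c * J.a * J.a = J.a * J.a * J.d * J.c := by
  linear_combination (norm := noncomm_ring) J.d * J.c * h.a_mul_a - h.a_mul_a * J.d * J.c -
    J.d * h.c_mul_b_mul_b * J.b + J.b * h.b_mul_b_mul_d * J.c -
    algebraMap k B lam * h.d_mul_c_mul_b_mul_b + Algebra.commutes lam (J.d * J.c) * J.b * J.b

theorem centralZ_mem_center (hJ : Algebra.adjoin k J.generators = ⊤) (h : J.IsPotential lam) :
    J.centralZ ∈ Subalgebra.center k B := by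
  apply Subalgebra.neg_mem
  apply mem_center_of_forall_commute hJ
  · linear_combination (norm := noncomm_ring) J.c * J.a * J.d_mul_eR + J.a * J.d * J.c_mul_eR +
      J.d * J.c * J.a_mul_eR + J.a * J.b * J.b_mul_eR - J.eR_mul_c * J.a * J.d -
      J.eR_mul_a * J.d * J.c - J.eR_mul_d * J.c * J.a - J.eR_mul_a * J.b * J.b
  · linear_combination (norm := noncomm_ring) J.c * J.a * J.d_mul_a - J.a_mul_c * J.a * J.d +
      h.d_mul_c_mul_a_mul_a - J.a * h.a_mul_b_mul_b
  · linear_combination (norm := noncomm_ring) J.c * J.a * J.d_mul_b - J.b_mul_c * J.a * J.d +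
      J.a * h.a_mul_a - h.a_mul_a * J.a - algebraMap k B lam * h.a_mul_b_mul_b +
      J.b * J.b * h.a_mul_b + h.a_mul_b_mul_b * J.b - h.a_mul_b * J.b * J.b +
      J.d * J.c * h.a_mul_b - h.a_mul_b * J.d * J.c + Algebra.commutes lam J.a * J.b * J.b
  · linear_combination (norm := noncomm_ring) J.a * J.d * J.c_mul_c + J.d * J.c * J.a_mul_c +
      J.a * J.b * J.b_mul_c - J.c_mul_c * J.a * J.d - h.c_mul_b_mul_b * J.a -
      J.c * h.a_mul_b_mul_b
  · linear_combination (norm := noncomm_ring) J.c * J.a * J.d_mul_d + J.a * h.b_mul_b_mul_d -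
      J.d_mul_a * J.d * J.c - J.d_mul_d * J.c * J.a - J.d_mul_a * J.b * J.b

end

section

variable {T B : Type*} [CommRing T] [Ring B] [Algebra T B] (J : QuiverRep B) (u w y z : T)

/-- The relations between the generators as an algebra over its central elements `w`, `y`, `z`:
on `M` the loops are the quaternion units `i` and `j`, and `dc` commutes with them up to
`QuatOrder.twist` and `QuatOrder.skewDeriv`. -/
structure IsOrder : Prop where
  c_mul_d : J.c * J.d = w • J.eR
  c_mul_a_mul_d : J.c * J.a * J.d = -z • J.eR
  c_mul_b_mul_d : J.c * J.b * J.d = y • J.eR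
  a_mul_a : J.a * J.a = -u • J.eM
  b_mul_b : J.b * J.b = -w • J.eM
  b_mul_a : J.b * J.a = -(J.a * J.b)
  d_mul_c_mul_a : J.d * J.c * J.a = -(J.a * J.d * J.c) - z • J.eM + w • J.a
  d_mul_c_mul_b : J.d * J.c * J.b = -(J.b * J.d * J.c) + y • J.eM + w • J.b

end

section

variable {k T B : Type*} [CommRing k] [CommRing T] [Algebra k T] [Ring B] [Algebra k B]
  [Algebra T B] [IsScalarTower k T B] {J : QuiverRep B} {lam : k} {w y z : T}

theorem IsPotential.isOrder (h : J.IsPotential lam) (hw : algebraMap T B w = J.centralW)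
    (hy : algebraMap T B y = J.centralY) (hz : algebraMap T B z = J.centralZ) :
    J.IsOrder (y - algebraMap k T lam * w) w y z := by
  have hlam : algebraMap T B (algebraMap k T lam) = algebraMap k B lam :=
    (IsScalarTower.algebraMap_apply k T B lam).symm
  constructor
  case b_mul_a => exact eq_neg_of_add_eq_zero_right h.a_mul_b
  all_goals simp only [Algebra.smul_def, map_neg, map_sub, map_mul, hw, hy, hz, hlam, centralW,
    centralY, centralZ, J.eM_eq]
  · linear_combination (norm := noncomm_ring) -J.c * J.d_mul_eR + J.b * J.b_mul_eR
  · linear_combination (norm := noncomm_ring) -J.c * J.a * J.d_mul_eR - J.a * J.d * J.c_mul_eR -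
      J.d * J.c * J.a_mul_eR - J.a * J.b * J.b_mul_eR
  · linear_combination (norm := noncomm_ring) -J.c * J.b * J.d_mul_eR - J.b * J.d * J.c_mul_eR -
      J.d * J.c * J.b_mul_eR - J.b * J.b * J.b_mul_eR
  · linear_combination (norm := noncomm_ring) h.a_mul_a - J.c * J.b * J.d_mul_eR -
      J.b * J.d * J.c_mul_eR - J.d * J.c * J.b_mul_eR - J.b * J.b * J.b_mul_eR +
      algebraMap k B lam * J.c * J.d_mul_eR - algebraMap k B lam * J.b * J.b_mul_eR
  · linear_combination (norm := noncomm_ring) -J.c * J.d_mul_eR + J.b * J.b_mul_eR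
  · linear_combination (norm := noncomm_ring) J.c * J.a * J.d_mul_eR + J.a * J.d * J.c_mul_eR +
      J.d * J.c * J.a_mul_eR + J.a * J.b * J.b_mul_eR - J.c * J.d_mul_a - h.a_mul_b_mul_b
  · linear_combination (norm := noncomm_ring) J.c * J.b * J.d_mul_eR + J.b * J.d * J.c_mul_eR +
      J.d * J.c * J.b_mul_eR + J.b * J.b * J.b_mul_eR - J.c * J.d_mul_b

end

section

variable {T B : Type*} [CommRing T] [Ring B] [Algebra T B] {J : QuiverRep B} {u w y z : T}

namespace IsOrder

theorem b_mul_b_mul_b (K : J.IsOrder u w y z) : J.b * J.b * J.b = -w • J.b := by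
  rw [K.b_mul_b, smul_mul_assoc, J.eM_mul_b]

theorem algebraMap_w (K : J.IsOrder u w y z) : algebraMap T B w = J.centralW := by
  rw [centralW, K.c_mul_d, K.b_mul_b, Algebra.algebraMap_eq_smul_one, ← J.eR_add_eM]
  module

theorem algebraMap_y (K : J.IsOrder u w y z) : algebraMap T B y = J.centralY := by
  rw [centralY, K.c_mul_b_mul_d, K.d_mul_c_mul_b, K.b_mul_b_mul_b,
    Algebra.algebraMap_eq_smul_one, ← J.eR_add_eM]
  module

theorem algebraMap_z (K : J.IsOrder u w y z) : algebraMap T B z = J.centralZ := by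
  rw [centralZ, K.c_mul_a_mul_d, K.d_mul_c_mul_a, mul_assoc J.a J.b, K.b_mul_b, mul_smul_comm,
    J.a_mul_eM, Algebra.algebraMap_eq_smul_one, ← J.eR_add_eM]
  module

theorem isPotential {k : Type*} [CommRing k] [Algebra k T] [Algebra k B] [IsScalarTower k T B]
    {lam : k} (K : J.IsOrder (y - algebraMap k T lam * w) w y z) : J.IsPotential lam where
  b_mul_b_mul_d := by
    rw [K.b_mul_b, mul_assoc J.d, K.c_mul_d, smul_mul_assoc, mul_smul_comm, J.eM_mul_d,
      J.d_mul_eR]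
    module
  c_mul_b_mul_b := by
    rw [mul_assoc, K.b_mul_b, K.c_mul_d, smul_mul_assoc, mul_smul_comm, J.eR_mul_c, J.c_mul_eM]
    module
  a_mul_b := by rw [K.b_mul_a, add_neg_cancel]
  a_mul_a := by
    rw [K.a_mul_a, K.d_mul_c_mul_b, K.b_mul_b_mul_b, mul_assoc (algebraMap k B lam), K.b_mul_b,
      IsScalarTower.algebraMap_apply k T B, ← Algebra.smul_def (algebraMap k T lam)]
    module

end IsOrder

open QuatOrder

variable (J u w) in
/-- The action on `M` of quaternions, through `i ↦ a` and `j ↦ b`. -/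
def quatEval : QuatOrder u w →ₗ[T] B where
  toFun h := h.re • J.eM + h.imI • J.a + h.imJ • J.b + h.imK • (J.a * J.b)
  map_add' h h' := by
    simp only [QuaternionAlgebra.re_add, QuaternionAlgebra.imI_add, QuaternionAlgebra.imJ_add,
      QuaternionAlgebra.imK_add]
    module
  map_smul' t h := by
    simp only [QuaternionAlgebra.re_smul, QuaternionAlgebra.imI_smul, QuaternionAlgebra.imJ_smul,
      QuaternionAlgebra.imK_smul, RingHom.id_apply, smul_eq_mul]
    module

variable (J) in
/-- The action on `R` of the quadratic order; `ω` acts as `-cabd` because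
`pairing y z k = -ω`. -/
def quadEval : QuadOrder u w y z →ₗ[T] B where
  toFun r := r.re • J.eR - r.im • (J.c * J.a * J.b * J.d)
  map_add' r r' := by
    simp only [QuadraticAlgebra.re_add, QuadraticAlgebra.im_add]
    module
  map_smul' t r := by
    simp only [QuadraticAlgebra.re_smul, QuadraticAlgebra.im_smul, RingHom.id_apply, smul_eq_mul]
    module

theorem quatEval_apply (h : QuatOrder u w) : J.quatEval u w h =
    h.re • J.eM + h.imI • J.a + h.imJ • J.b + h.imK • (J.a * J.b) := rfl

theorem quadEval_apply (r : QuadOrder u w y z) :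
    J.quadEval r = r.re • J.eR - r.im • (J.c * J.a * J.b * J.d) := rfl

theorem eR_mul_quadEval (r : QuadOrder u w y z) : J.eR * J.quadEval r = J.quadEval r := by
  simp only [quadEval_apply, mul_sub, mul_smul_comm, ← mul_assoc, J.eR_mul_eR, J.eR_mul_c]

theorem eR_mul_quatEval (h : QuatOrder u w) : J.eR * J.quatEval u w h = 0 := by
  simp only [quatEval_apply, mul_add, mul_smul_comm, ← mul_assoc, J.eR_mul_eM, J.eR_mul_a,
    J.eR_mul_b, zero_mul, smul_zero, add_zero]

theorem a_mul_quadEval (r : QuadOrder u w y z) : J.a * J.quadEval r = 0 := by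
  simp only [quadEval_apply, mul_sub, mul_smul_comm, ← mul_assoc, J.a_mul_eR, J.a_mul_c,
    zero_mul, smul_zero, sub_zero]

theorem b_mul_quadEval (r : QuadOrder u w y z) : J.b * J.quadEval r = 0 := by
  simp only [quadEval_apply, mul_sub, mul_smul_comm, ← mul_assoc, J.b_mul_eR, J.b_mul_c,
    zero_mul, smul_zero, sub_zero]

theorem c_mul_quadEval (r : QuadOrder u w y z) : J.c * J.quadEval r = 0 := by
  simp only [quadEval_apply, mul_sub, mul_smul_comm, ← mul_assoc, J.c_mul_eR, J.c_mul_c,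
    zero_mul, smul_zero, sub_zero]

theorem d_mul_quatEval (h : QuatOrder u w) : J.d * J.quatEval u w h = 0 := by
  simp only [quatEval_apply, mul_add, mul_smul_comm, ← mul_assoc, J.d_mul_eM, J.d_mul_a,
    J.d_mul_b, zero_mul, smul_zero, add_zero]

theorem quatEval_one : J.quatEval u w 1 = J.eM := by
  simp [quatEval_apply]

namespace IsOrder

theorem a_mul_quatEval (K : J.IsOrder u w y z) (h : QuatOrder u w) :
    J.a * J.quatEval u w h = J.quatEval u w (i * h) := by
  simp only [quatEval_apply, mul_add, mul_smul_comm, ← mul_assoc, J.a_mul_eM, K.a_mul_a,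
    smul_mul_assoc, J.eM_mul_b]
  simp
  module

theorem b_mul_quatEval (K : J.IsOrder u w y z) (h : QuatOrder u w) :
    J.b * J.quatEval u w h = J.quatEval u w (j * h) := by
  have hbab : J.b * J.a * J.b = w • J.a := by
    rw [K.b_mul_a, neg_mul, mul_assoc, K.b_mul_b, mul_smul_comm, J.a_mul_eM, neg_smul, neg_neg]
  simp only [quatEval_apply, mul_add, mul_smul_comm, ← mul_assoc, J.b_mul_eM, K.b_mul_b, hbab]
  rw [K.b_mul_a]
  simp
  module

theorem c_mul_quatEval_mul_d (K : J.IsOrder u w y z) (h : QuatOrder u w) :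
    J.c * J.quatEval u w h * J.d = J.quadEval (pairing y z h) := by
  simp only [quatEval_apply, quadEval_apply, re_pairing, im_pairing, mul_add, mul_smul_comm,
    add_mul, smul_mul_assoc, ← mul_assoc, J.c_mul_eM, K.c_mul_d, K.c_mul_a_mul_d, K.c_mul_b_mul_d]
  module

theorem d_mul_c_mul_a_mul_b (K : J.IsOrder u w y z) :
    J.d * J.c * J.a * J.b = J.a * J.b * J.d * J.c - y • J.a - z • J.b := by
  have h : J.a * J.d * J.c * J.b = -(J.a * J.b * J.d * J.c) + y • J.a + w • (J.a * J.b) := by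
    rw [mul_assoc J.a, mul_assoc J.a, K.d_mul_c_mul_b]
    simp only [mul_add, mul_neg, mul_smul_comm, ← mul_assoc, J.a_mul_eM]
  rw [K.d_mul_c_mul_a]
  simp only [add_mul, sub_mul, neg_mul, smul_mul_assoc, J.eM_mul_b, h]
  module

theorem d_mul_c_mul_quatEval (K : J.IsOrder u w y z) (h : QuatOrder u w) :
    J.d * J.c * J.quatEval u w h =
      J.quatEval u w (twist h) * J.d * J.c + J.quatEval u w (skewDeriv y z h) := by
  have hd : J.d * J.c * J.eM = J.d * J.c := by rw [mul_assoc, J.c_mul_eM]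
  simp only [quatEval_apply, twist, skewDeriv, mul_add, mul_smul_comm, ← mul_assoc, hd,
    K.d_mul_c_mul_a_mul_b, add_mul, smul_mul_assoc, J.eM_mul_d]
  rw [K.d_mul_c_mul_a, K.d_mul_c_mul_b]
  module

theorem quadEval_mul_c (K : J.IsOrder u w y z) (r : QuadOrder u w y z) :
    J.quadEval r * J.c = J.c * J.quatEval u w (twist (ofQuad y z r)) := by
  have h : J.a * J.b * J.d * J.c = J.d * J.c * J.a * J.b + y • J.a + z • J.b := by
    rw [K.d_mul_c_mul_a_mul_b]; abel
  have h' : J.c * J.a * J.b * J.d * J.c = J.c * (J.a * J.b * J.d * J.c) := by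
    simp only [mul_assoc]
  have h'' : J.c * J.d * J.c * J.a * J.b = w • (J.c * J.a * J.b) := by
    rw [K.c_mul_d, smul_mul_assoc, J.eR_mul_c, smul_mul_assoc, smul_mul_assoc]
  simp only [quadEval_apply, quatEval_apply, ofQuad_apply, twist, sub_mul, smul_mul_assoc, h', h,
    mul_add, mul_smul_comm, ← mul_assoc, h'', J.eR_mul_c, J.c_mul_eM]
  simp
  module

theorem d_mul_quadEval (K : J.IsOrder u w y z) (r : QuadOrder u w y z) :
    J.d * J.quadEval r = J.quatEval u w (ofQuad y z r) * J.d := by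
  have h : J.a * J.b * J.d * J.c * J.d = w • (J.a * J.b * J.d) := by
    rw [mul_assoc _ J.c, K.c_mul_d, mul_smul_comm, mul_assoc _ J.d, J.d_mul_eR]
  simp only [quadEval_apply, quatEval_apply, ofQuad_apply, mul_sub, mul_smul_comm, ← mul_assoc,
    K.d_mul_c_mul_a_mul_b, sub_mul, add_mul, smul_mul_assoc, h, J.eM_mul_d, J.d_mul_eR]
  simp
  module

end IsOrder

variable (J u w y z) in
/-- The normal form of an element, `T`-linear in its coefficients. The five summands lie in
`Hom(R, R)`, `Hom(R, M)`, `Hom(M, R)` and twice in `Hom(M, M)`. -/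
def normalForm : (QuadOrder u w y z × QuatOrder u w × QuatOrder u w ×
    QuatOrder u w × QuatOrder u w) →ₗ[T] B where
  toFun x := J.quadEval x.1 + J.quatEval u w x.2.1 * J.d + J.c * J.quatEval u w x.2.2.1 +
    J.quatEval u w x.2.2.2.1 + J.quatEval u w x.2.2.2.2 * J.d * J.c
  map_add' x x' := by
    simp only [Prod.fst_add, Prod.snd_add, map_add, add_mul, mul_add]
    abel
  map_smul' t x := by
    simp only [Prod.smul_fst, Prod.smul_snd, map_smul, smul_mul_assoc, mul_smul_comm, smul_add,
      RingHom.id_apply]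

theorem normalForm_apply (r : QuadOrder u w y z) (p q h k : QuatOrder u w) :
    J.normalForm u w y z (r, p, q, h, k) = J.quadEval r + J.quatEval u w p * J.d +
      J.c * J.quatEval u w q + J.quatEval u w h + J.quatEval u w k * J.d * J.c := rfl

theorem eR_mul_normalForm (r : QuadOrder u w y z) (p q h k : QuatOrder u w) :
    J.eR * J.normalForm u w y z (r, p, q, h, k) = J.normalForm u w y z (r, 0, q, 0, 0) := by
  simp only [normalForm_apply, mul_add, ← mul_assoc, eR_mul_quadEval, eR_mul_quatEval,
    J.eR_mul_c, map_zero, zero_mul, add_zero]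

namespace IsOrder

theorem a_mul_normalForm (K : J.IsOrder u w y z) (r : QuadOrder u w y z)
    (p q h k : QuatOrder u w) : J.a * J.normalForm u w y z (r, p, q, h, k) =
      J.normalForm u w y z (0, i * p, 0, i * h, i * k) := by
  simp only [normalForm_apply, mul_add, ← mul_assoc, a_mul_quadEval, K.a_mul_quatEval,
    J.a_mul_c, zero_mul, map_zero, mul_zero, zero_add, add_zero]

theorem b_mul_normalForm (K : J.IsOrder u w y z) (r : QuadOrder u w y z)
    (p q h k : QuatOrder u w) : J.b * J.normalForm u w y z (r, p, q, h, k) =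
      J.normalForm u w y z (0, j * p, 0, j * h, j * k) := by
  simp only [normalForm_apply, mul_add, ← mul_assoc, b_mul_quadEval, K.b_mul_quatEval,
    J.b_mul_c, zero_mul, map_zero, mul_zero, zero_add, add_zero]

theorem c_mul_normalForm (K : J.IsOrder u w y z) (r : QuadOrder u w y z)
    (p q h k : QuatOrder u w) : J.c * J.normalForm u w y z (r, p, q, h, k) =
      J.normalForm u w y z (pairing y z p, 0, h + twist (dc y z k), 0, 0) := by
  simp only [normalForm_apply, mul_add, ← mul_assoc, c_mul_quadEval, K.c_mul_quatEval_mul_d,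
    K.quadEval_mul_c, J.c_mul_c, map_add, zero_mul, map_zero, zero_add, add_zero]
  exact add_assoc _ _ _

theorem d_mul_normalForm (K : J.IsOrder u w y z) (r : QuadOrder u w y z)
    (p q h k : QuatOrder u w) : J.d * J.normalForm u w y z (r, p, q, h, k) =
      J.normalForm u w y z (0, ofQuad y z r, 0, skewDeriv y z q, twist q) := by
  simp only [normalForm_apply, mul_add, ← mul_assoc, K.d_mul_quadEval, d_mul_quatEval,
    K.d_mul_c_mul_quatEval, zero_mul, map_zero, mul_zero, zero_add, add_zero]
  abel

theorem normalForm_surjective (K : J.IsOrder u w y z)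
    (hJ : Algebra.adjoin T J.generators = ⊤) :
    Function.Surjective (J.normalForm u w y z) := by
  have mul_mem : ∀ v : B, ∀ x ∈ LinearMap.range (J.normalForm u w y z),
      v * x ∈ LinearMap.range (J.normalForm u w y z) := by
    intro v
    have hv : v ∈ Algebra.adjoin T J.generators := hJ ▸ Algebra.mem_top
    induction hv using Algebra.adjoin_induction with
    | mem g hg =>
      rintro _ ⟨⟨r, p, q, h, k⟩, rfl⟩
      rcases hg with rfl | rfl | rfl | rfl | rfl
      · exact ⟨_, (eR_mul_normalForm r p q h k).symm⟩
      · exact ⟨_, (K.a_mul_normalForm r p q h k).symm⟩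
      · exact ⟨_, (K.b_mul_normalForm r p q h k).symm⟩
      · exact ⟨_, (K.c_mul_normalForm r p q h k).symm⟩
      · exact ⟨_, (K.d_mul_normalForm r p q h k).symm⟩
    | algebraMap t =>
      intro x hx
      rw [← Algebra.smul_def]
      exact Submodule.smul_mem _ t hx
    | add v v' _ _ hv hv' =>
      intro x hx
      rw [add_mul]
      exact add_mem (hv x hx) (hv' x hx)
    | mul v v' _ _ hv hv' =>
      intro x hx
      rw [mul_assoc]
      exact hv _ (hv' x hx)
  have one_mem : (1 : B) ∈ LinearMap.range (J.normalForm u w y z) :=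
    ⟨(1, 0, 0, 1, 0), by
      simp [normalForm_apply, quadEval_apply, quatEval_one, QuadraticAlgebra.re_one,
        QuadraticAlgebra.im_one, J.eR_add_eM]⟩
  exact fun v => mul_one v ▸ mul_mem v 1 one_mem

end IsOrder

theorem normalForm_map {B' : Type*} [Ring B'] [Algebra T B'] (φ : B →ₐ[T] B')
    (x : QuadOrder u w y z × QuatOrder u w × QuatOrder u w × QuatOrder u w × QuatOrder u w) :
    (J.map φ).normalForm u w y z x = φ (J.normalForm u w y z x) := by
  obtain ⟨r, p, q, h, k⟩ := x
  simp only [normalForm_apply, quadEval_apply, quatEval_apply, map_a, map_b, map_c, map_d, map_eR,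
    map_eM, map_add, map_sub, map_mul, map_smul]

theorem IsOrder.bijective_of_bijective_normalForm_map {B' : Type*} [Ring B'] [Algebra T B']
    (K : J.IsOrder u w y z) (hJ : Algebra.adjoin T J.generators = ⊤) (φ : B →ₐ[T] B')
    (hφ : Function.Bijective ((J.map φ).normalForm u w y z)) : Function.Bijective φ := by
  have hcomp : (J.map φ).normalForm u w y z = φ ∘ J.normalForm u w y z :=
    funext (normalForm_map φ)
  rw [hcomp] at hφ
  exact ⟨hφ.1.of_comp_right (K.normalForm_surjective hJ), hφ.2.of_comp⟩

end

section

open MvPolynomial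

variable {k B B' : Type*} [CommRing k] [Ring B] [Algebra k B] [Ring B'] [Algebra k B']
  {J : QuiverRep B} {lam : k}

/-- The action of `k[z, w, y]` through the central elements. -/
noncomputable def centralHom (hJ : Algebra.adjoin k J.generators = ⊤) (h : J.IsPotential lam) :
    MvPolynomial (Fin 3) k →ₐ[k] Subalgebra.center k B :=
  aeval ![⟨J.centralZ, centralZ_mem_center hJ h⟩, ⟨J.centralW, centralW_mem_center hJ h⟩,
    ⟨J.centralY, centralY_mem_center hJ h⟩]

theorem bijective_of_isOrder_map [Algebra (MvPolynomial (Fin 3) k) B']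
    [IsScalarTower k (MvPolynomial (Fin 3) k) B'] (hJ : Algebra.adjoin k J.generators = ⊤)
    (h : J.IsPotential lam) (φ : B →ₐ[k] B')
    (hφ : (J.map φ).IsOrder (X 2 - C lam * X 1 : MvPolynomial (Fin 3) k) (X 1) (X 2) (X 0))
    (hbij : Function.Bijective ((J.map φ).normalForm
      (X 2 - C lam * X 1 : MvPolynomial (Fin 3) k) (X 1) (X 2) (X 0))) :
    Function.Bijective φ := by
  let ρ : MvPolynomial (Fin 3) k →ₐ[k] B := (Subalgebra.center k B).val.comp (centralHom hJ h)
  let : Algebra (MvPolynomial (Fin 3) k) B := ρ.toRingHom.toAlgebra'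
    fun t v => (Subalgebra.mem_center_iff.mp (centralHom hJ h t).2 v).symm
  have : IsScalarTower k (MvPolynomial (Fin 3) k) B :=
    .of_algebraMap_eq fun r => (ρ.commutes r).symm
  have hz : ρ (X 0) = J.centralZ := congrArg Subtype.val (aeval_X _ 0)
  have hw : ρ (X 1) = J.centralW := congrArg Subtype.val (aeval_X _ 1)
  have hy : ρ (X 2) = J.centralY := congrArg Subtype.val (aeval_X _ 2)
  have hgen : Algebra.adjoin (MvPolynomial (Fin 3) k) J.generators = ⊤ := by
    have hle : (⊤ : Subalgebra k B) ≤
        (Algebra.adjoin (MvPolynomial (Fin 3) k) J.generators).restrictScalars k :=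
      hJ.symm.trans_le (Algebra.adjoin_le Algebra.subset_adjoin)
    exact Algebra.eq_top_iff.mpr fun v => hle Algebra.mem_top
  have hρ : φ.comp ρ = IsScalarTower.toAlgHom k (MvPolynomial (Fin 3) k) B' := by
    refine MvPolynomial.algHom_ext fun n => ?_
    fin_cases n
    · exact (congrArg φ hz).trans ((J.map_centralZ φ).symm.trans hφ.algebraMap_z.symm)
    · exact (congrArg φ hw).trans ((J.map_centralW φ).symm.trans hφ.algebraMap_w.symm)
    · exact (congrArg φ hy).trans ((J.map_centralY φ).symm.trans hφ.algebraMap_y.symm)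
  exact (h.isOrder hw hy hz).bijective_of_bijective_normalForm_map hgen
    { φ with commutes' := AlgHom.congr_fun hρ } hbij

end

end QuiverRep

namespace QuiverRep

open QuatOrder LinearMap

section

variable {S N : Type*} [CommRing S] [AddCommGroup N] [Module S N]

/-- The representation in `End_S(S ⊕ N)` given by the projections onto the two summands and by
maps between them. -/
def ofMaps (a b : N →ₗ[S] N) (c : N →ₗ[S] S) (d : S →ₗ[S] N) :
    QuiverRep (Module.End S (S × N)) where
  eR := inl S S N ∘ₗ fst S S N
  eM := inr S S N ∘ₗ snd S S N
  a := inr S S N ∘ₗ a ∘ₗ snd S S N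
  b := inr S S N ∘ₗ b ∘ₗ snd S S N
  c := inl S S N ∘ₗ c ∘ₗ snd S S N
  d := inr S S N ∘ₗ d ∘ₗ fst S S N
  eR_add_eM := by ext <;> simp
  eR_mul_eR := by ext <;> simp
  a_mul_eR := by ext <;> simp
  eR_mul_a := by ext <;> simp
  b_mul_eR := by ext <;> simp
  eR_mul_b := by ext <;> simp
  c_mul_eR := by ext <;> simp
  eR_mul_c := by ext <;> simp
  d_mul_eR := by ext <;> simp
  eR_mul_d := by ext <;> simp

variable {T : Type*} [CommRing T] {u w y z : T} [Algebra T S] [Module T N]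

/-- An identification of a ring `S` with the quadratic order, and of an `S`-module `N` with the
quaternion order on which the quadratic order acts from the right, in such a way that `a` and `b`
become the left multiplications by `i` and `j`, that `c` becomes the pairing, and that `d` becomes
the embedding of the quadratic order. -/
structure IsQuatModel (a b : N →ₗ[S] N) (c : N →ₗ[S] S) (d : S →ₗ[S] N)
    (ρ : QuadOrder u w y z ≃ₐ[T] S) (m : QuatOrder u w ≃ₗ[T] N) : Prop where
  map_mul_xi (h : QuatOrder u w) : m (h * xi y z) = ρ QuadraticAlgebra.omega • m h
  a_map (h : QuatOrder u w) : a (m h) = m (i * h)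
  b_map (h : QuatOrder u w) : b (m h) = m (j * h)
  c_map (h : QuatOrder u w) : c (m h) = ρ (pairing y z h)
  d_one : d 1 = m 1

namespace IsQuatModel

variable {a b : N →ₗ[S] N} {c : N →ₗ[S] S} {d : S →ₗ[S] N}
  {ρ : QuadOrder u w y z ≃ₐ[T] S} {m : QuatOrder u w ≃ₗ[T] N}

theorem end_ext (ρ : QuadOrder u w y z ≃ₐ[T] S) (m : QuatOrder u w ≃ₗ[T] N)
    {F G : Module.End S (S × N)} (h : ∀ r v, F (ρ r, m v) = G (ρ r, m v)) : F = G := by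
  refine LinearMap.ext fun ⟨r, v⟩ => ?_
  simpa using h (ρ.symm r) (m.symm v)

theorem a_apply (H : IsQuatModel a b c d ρ m) (r : QuadOrder u w y z) (v : QuatOrder u w) :
    (ofMaps a b c d).a (ρ r, m v) = (ρ 0, m (i * v)) := by
  simp [ofMaps, H.a_map]

theorem b_apply (H : IsQuatModel a b c d ρ m) (r : QuadOrder u w y z) (v : QuatOrder u w) :
    (ofMaps a b c d).b (ρ r, m v) = (ρ 0, m (j * v)) := by
  simp [ofMaps, H.b_map]

theorem c_apply (H : IsQuatModel a b c d ρ m) (r : QuadOrder u w y z) (v : QuatOrder u w) :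
    (ofMaps a b c d).c (ρ r, m v) = (ρ (pairing y z v), m 0) := by
  simp [ofMaps, H.c_map]

theorem eR_apply (a b : N →ₗ[S] N) (c : N →ₗ[S] S) (d : S →ₗ[S] N)
    (ρ : QuadOrder u w y z ≃ₐ[T] S) (m : QuatOrder u w ≃ₗ[T] N)
    (r : QuadOrder u w y z) (v : QuatOrder u w) :
    (ofMaps a b c d).eR (ρ r, m v) = (ρ r, m 0) := by
  simp [ofMaps]

theorem eM_apply (a b : N →ₗ[S] N) (c : N →ₗ[S] S) (d : S →ₗ[S] N)
    (ρ : QuadOrder u w y z ≃ₐ[T] S) (m : QuatOrder u w ≃ₗ[T] N)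
    (r : QuadOrder u w y z) (v : QuatOrder u w) :
    (ofMaps a b c d).eM (ρ r, m v) = (ρ 0, m v) := by
  simp [ofMaps]

variable [IsScalarTower T S N]

theorem map_mul_ofQuad (H : IsQuatModel a b c d ρ m) (h : QuatOrder u w)
    (r : QuadOrder u w y z) : m (h * ofQuad y z r) = ρ r • m h :=
  map_mul_ofQuad_of_map_mul_xi (ρ := ρ.toAlgHom) (m := m.toLinearMap) H.map_mul_xi h r

theorem d_map (H : IsQuatModel a b c d ρ m) (r : QuadOrder u w y z) :
    d (ρ r) = m (ofQuad y z r) := by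
  rw [← mul_one (ρ r), ← smul_eq_mul, map_smul, H.d_one, ← H.map_mul_ofQuad, one_mul]

theorem d_apply (H : IsQuatModel a b c d ρ m) (r : QuadOrder u w y z) (v : QuatOrder u w) :
    (ofMaps a b c d).d (ρ r, m v) = (ρ 0, m (ofQuad y z r)) := by
  simp [ofMaps, H.d_map]

theorem isOrder (H : IsQuatModel a b c d ρ m) : (ofMaps a b c d).IsOrder u w y z := by
  constructor <;> refine end_ext ρ m fun r v => ?_ <;>
    simp only [Module.End.mul_apply, LinearMap.add_apply, LinearMap.sub_apply,
      LinearMap.smul_apply, LinearMap.neg_apply, H.a_apply, H.b_apply, H.c_apply, H.d_apply,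
      eR_apply a b c d ρ m, eM_apply a b c d ρ m, Prod.smul_mk, Prod.neg_mk, Prod.mk_add_mk,
      Prod.mk_sub_mk, ← map_smul, ← map_add, ← map_neg, ← map_sub, smul_zero, neg_zero,
      sub_zero, add_zero]
  · congr 2
    rw [← one_mul (ofQuad y z r), pairing_mul_ofQuad]
    ext <;> simp [re_pairing, im_pairing, mul_comm]
  · congr 2
    rw [pairing_mul_ofQuad]
    ext <;> simp [re_pairing, im_pairing, mul_comm]
  · congr 2
    rw [pairing_mul_ofQuad]
    ext <;> simp [re_pairing, im_pairing, mul_comm]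
  · rw [← mul_assoc, i_mul_i, smul_mul_assoc, one_mul]
  · rw [← mul_assoc, j_mul_j, smul_mul_assoc, one_mul]
  · rw [← mul_assoc, j_mul_i, neg_mul, mul_assoc]
  · congr 2
    change dc y z (i * v) = -(i * dc y z v) - z • v + w • (i * v)
    rw [dc_apply, dc_apply]
    ext1 <;> simp <;> ring
  · congr 2
    change dc y z (j * v) = -(j * dc y z v) + y • v + w • (j * v)
    rw [dc_apply, dc_apply]
    ext1 <;> simp <;> ring

theorem normalForm_ofMaps_apply (H : IsQuatModel a b c d ρ m) (r s : QuadOrder u w y z)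
    (p q h k v : QuatOrder u w) :
    (ofMaps a b c d).normalForm u w y z (r, p, q, h, k) (ρ s, m v) =
      (ρ (r * s + pairing y z (q * v)), m (p * ofQuad y z s + h * v + k * dc y z v)) := by
  have hquat (g v : QuatOrder u w) (s : QuadOrder u w y z) :
      (ofMaps a b c d).quatEval u w g (ρ s, m v) = (ρ 0, m (g * v)) := by
    simp only [quatEval_apply, LinearMap.add_apply, LinearMap.smul_apply, Module.End.mul_apply,
      eM_apply a b c d ρ m, H.a_apply, H.b_apply, Prod.smul_mk, Prod.mk_add_mk, ← map_smul,
      ← map_add, smul_zero, add_zero]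
    congr 2
    ext1 <;> simp <;> ring
  have hquad : (ofMaps a b c d).quadEval r (ρ s, m v) = (ρ (r * s), m 0) := by
    simp only [quadEval_apply, LinearMap.sub_apply, LinearMap.smul_apply, Module.End.mul_apply,
      eR_apply a b c d ρ m, H.a_apply, H.b_apply, H.c_apply, H.d_apply, Prod.smul_mk,
      Prod.mk_sub_mk, ← map_smul, ← map_sub, smul_zero, sub_zero]
    congr 2
    rw [← mul_assoc, map_smul, pairing_mul_ofQuad]
    ext <;> simp [re_pairing, im_pairing]; ring
  simp only [normalForm_apply, LinearMap.add_apply, Module.End.mul_apply, hquad, hquat,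
    H.c_apply, H.d_apply, Prod.mk_add_mk, ← map_add, add_zero, zero_add]
  rfl

theorem normalForm_injective [IsDomain T] (H : IsQuatModel a b c d ρ m)
    (hn : z ^ 2 + w ^ 2 * u ≠ 0) :
    Function.Injective ((ofMaps a b c d).normalForm u w y z) := by
  refine (injective_iff_map_eq_zero _).mpr fun ⟨r, p, q, h, k⟩ hzero => ?_
  have happ (s : QuadOrder u w y z) (v : QuatOrder u w) : r * s + pairing y z (q * v) = 0 ∧
      p * ofQuad y z s + h * v + k * dc y z v = 0 := by
    have := H.normalForm_ofMaps_apply r s p q h k v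
    rw [hzero, LinearMap.zero_apply, eq_comm, Prod.mk_eq_zero] at this
    exact ⟨(map_eq_zero_iff ρ ρ.injective).mp this.1, (map_eq_zero_iff m m.injective).mp this.2⟩
  obtain rfl : r = 0 := by simpa using (happ 1 0).1
  obtain rfl : p = 0 := by simpa using (happ 1 0).2
  obtain rfl : q = 0 := eq_zero_of_forall_pairing_mul fun v => by simpa using (happ 0 v).1
  obtain ⟨rfl, rfl⟩ := eq_zero_of_forall_mul_add_mul_dc hn fun v => by simpa using (happ 0 v).2
  rfl

theorem normalForm_surjective [IsDomain T] (H : IsQuatModel a b c d ρ m) (hw : w ≠ 0)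
    (hn : z ^ 2 + w ^ 2 * u ≠ 0)
    (hdvd : ∀ t, z ^ 2 + w ^ 2 * u ∣ (y ^ 2 + w ^ 3) * t → z ^ 2 + w ^ 2 * u ∣ t) :
    Function.Surjective ((ofMaps a b c d).normalForm u w y z) := by
  intro F
  let FT : S × N →ₗ[T] S × N := F.restrictScalars T
  have hF (t : S) (v : N) : F (0, t • v) = t • F (0, v) := by
    rw [← map_smul, Prod.smul_mk, smul_zero]
  obtain ⟨q, hq⟩ := exists_eq_pairing_mul y z
    (ρ.symm.toLinearMap ∘ₗ fst T S N ∘ₗ FT ∘ₗ inr T S N ∘ₗ m.toLinearMap) fun v => by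
      simp [FT, hF, H.map_mul_xi]
  obtain ⟨h, k, hhk⟩ := exists_eq_mul_add_mul_dc hw hn hdvd
    (F := m.symm.toLinearMap ∘ₗ snd T S N ∘ₗ FT ∘ₗ inr T S N ∘ₗ m.toLinearMap) fun v => by
      apply m.injective
      simp [FT, hF, H.map_mul_xi]
  refine ⟨(ρ.symm (F (1, 0)).1, m.symm (F (1, 0)).2, q, h, k), end_ext ρ m fun s v => ?_⟩
  have hsplit : F (ρ s, m v) = ρ s • F (1, 0) + F (0, m v) := by
    rw [← map_smul, ← map_add]
    simp
  rw [H.normalForm_ofMaps_apply, hsplit, ← hq, add_assoc, ← hhk]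
  ext <;> simp [FT, H.map_mul_ofQuad, mul_comm]

theorem normalForm_bijective [IsDomain T] (H : IsQuatModel a b c d ρ m) (hw : w ≠ 0)
    (hn : z ^ 2 + w ^ 2 * u ≠ 0)
    (hdvd : ∀ t, z ^ 2 + w ^ 2 * u ∣ (y ^ 2 + w ^ 3) * t → z ^ 2 + w ^ 2 * u ∣ t) :
    Function.Bijective ((ofMaps a b c d).normalForm u w y z) :=
  ⟨H.normalForm_injective hn, H.normalForm_surjective hw hn hdvd⟩

end IsQuatModel

end

section

open MvPolynomial

variable {k : Type*} [CommRing k] [IsDomain k] (lam : k)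

theorem sq_add_sq_mul_ne_zero :
    (X 0 ^ 2 + X 1 ^ 2 * (X 2 - C lam * X 1) : MvPolynomial (Fin 3) k) ≠ 0 := fun h => by
  have := congrArg (eval ![1, 0, 0]) h
  simp at this

-- The polynomial `z² + w² u` is monic in `z`, which is `X 0`, and `y² + w³` does not involve `z`.
theorem sq_add_sq_mul_dvd_of_dvd_mul (p : MvPolynomial (Fin 3) k)
    (h : X 0 ^ 2 + X 1 ^ 2 * (X 2 - C lam * X 1) ∣ (X 2 ^ 2 + X 1 ^ 3) * p) :
    X 0 ^ 2 + X 1 ^ 2 * (X 2 - C lam * X 1) ∣ p := by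
  let e := finSuccEquiv k 2
  have he_dvd {q q' : MvPolynomial (Fin 3) k} : q ∣ q' ↔ e q ∣ e q' := (map_dvd_iff e).symm
  have he_z : e (X 0) = Polynomial.X := finSuccEquiv_X_zero
  have he_w : e (X 1) = Polynomial.C (X 0) := finSuccEquiv_X_succ (j := 0)
  have he_y : e (X 2) = Polynomial.C (X 1) := finSuccEquiv_X_succ (j := 1)
  have he_lam : e (C lam) = Polynomial.C (C lam) := by simp [e, finSuccEquiv_apply]
  have he_left : e (X 0 ^ 2 + X 1 ^ 2 * (X 2 - C lam * X 1)) =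
      Polynomial.X ^ 2 + Polynomial.C ((X 0) ^ 2 * (X 1 - C lam * X 0)) := by
    simp [he_z, he_w, he_y, he_lam]
  have he_right : e (X 2 ^ 2 + X 1 ^ 3) = Polynomial.C ((X 1) ^ 2 + (X 0) ^ 3) := by
    simp [he_w, he_y]
  have h_ne : (X 1 ^ 2 + X 0 ^ 3 : MvPolynomial (Fin 2) k) ≠ 0 := fun h => by
    have := congrArg (eval ![0, 1]) h
    simp at this
  have h_monic := Polynomial.monic_X_pow_add_C ((X 0) ^ 2 * (X 1 - C lam * X 0) :
    MvPolynomial (Fin 2) k) two_ne_zero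
  rw [he_dvd, map_mul, he_right, he_left, ← Polynomial.smul_eq_C_mul,
    ← Polynomial.modByMonic_eq_zero_iff_dvd h_monic, Polynomial.smul_modByMonic] at h
  rw [he_dvd, he_left, ← Polynomial.modByMonic_eq_zero_iff_dvd h_monic]
  exact (smul_eq_zero.mp h).resolve_left h_ne

end

section

open MvPolynomial

variable {k S N : Type*} [CommRing k] [CommRing S] [Algebra k S] [AddCommGroup N] [Module k N]
  [Module S N] [IsScalarTower k S N] [Algebra (MvPolynomial (Fin 3) k) S]
  [IsScalarTower k (MvPolynomial (Fin 3) k) S] [Module (MvPolynomial (Fin 3) k) N]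
  [IsScalarTower (MvPolynomial (Fin 3) k) S N] {lam : k}
  {a b : N →ₗ[S] N} {c : N →ₗ[S] S} {d : S →ₗ[S] N}
  {ρ : QuadOrder (X 2 - C lam * X 1 : MvPolynomial (Fin 3) k) (X 1) (X 2) (X 0)
    ≃ₐ[MvPolynomial (Fin 3) k] S}
  {m : QuatOrder (X 2 - C lam * X 1 : MvPolynomial (Fin 3) k) (X 1)
    ≃ₗ[MvPolynomial (Fin 3) k] N}

theorem IsQuatModel.isPotential (H : IsQuatModel a b c d ρ m) :
    (ofMaps a b c d).IsPotential lam := by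
  have : IsScalarTower k (MvPolynomial (Fin 3) k) N := .to₁₂₄ k _ S N
  have : IsScalarTower k (MvPolynomial (Fin 3) k) (Module.End S (S × N)) :=
    ⟨fun r t F => LinearMap.ext fun v => smul_assoc r t (F v)⟩
  exact H.isOrder.isPotential

theorem IsQuatModel.bijective_of_map_eq [IsDomain k] (H : IsQuatModel a b c d ρ m)
    {B : Type*} [Ring B] [Algebra k B] {J : QuiverRep B}
    (hJ : Algebra.adjoin k J.generators = ⊤) (h : J.IsPotential lam)
    (φ : B →ₐ[k] Module.End S (S × N)) (hφ : J.map φ = ofMaps a b c d) :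
    Function.Bijective φ := by
  have : IsScalarTower k (MvPolynomial (Fin 3) k) N := .to₁₂₄ k _ S N
  have : IsScalarTower k (MvPolynomial (Fin 3) k) (Module.End S (S × N)) :=
    ⟨fun r t F => LinearMap.ext fun v => smul_assoc r t (F v)⟩
  refine bijective_of_isOrder_map hJ h φ ?_ ?_ <;> rw [hφ]
  · exact H.isOrder
  · exact H.normalForm_bijective (X_ne_zero 1) (sq_add_sq_mul_ne_zero lam)
      (sq_add_sq_mul_dvd_of_dvd_mul lam)

end

end QuiverRep

namespace MorrisonPinkham

open MvPolynomial QuatOrder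

/-- The polynomial ring `ℂ[z, w, y]`, over which `R` has rank two. -/
abbrev T : Type := MvPolynomial (Fin 3) ℂ

/-- The variable `z` of `T`. -/
noncomputable abbrev tz : T := X 0

/-- The variable `w` of `T`. -/
noncomputable abbrev tw : T := X 1

/-- The variable `y` of `T`. -/
noncomputable abbrev ty : T := X 2

/-- The element `u = y - λ w` of `T`. -/
noncomputable abbrev tu (lam : ℂ) : T := ty - C lam * tw

variable (lam : ℂ)

/-- The quotient map `S → R`. -/
noncomputable abbrev toR : S →ₐ[ℂ] R lam := Ideal.Quotient.mkₐ ℂ (Ideal.span {f lam})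

/-- `R` is an algebra over its subring `ℂ[z, w, y]`. -/
noncomputable instance : Algebra T (R lam) :=
  (aeval ![toR lam z, toR lam w, toR lam y] : T →ₐ[ℂ] R lam).toAlgebra

noncomputable instance : Module T (R lam) := Algebra.toModule

instance : IsScalarTower ℂ T (R lam) :=
  IsScalarTower.of_algHom (aeval ![toR lam z, toR lam w, toR lam y])

@[simp] theorem algebraMap_tz : algebraMap T (R lam) tz = toR lam z :=
  aeval_X ..

@[simp] theorem algebraMap_tw : algebraMap T (R lam) tw = toR lam w :=
  aeval_X ..

@[simp] theorem algebraMap_ty : algebraMap T (R lam) ty = toR lam y :=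
  aeval_X ..

@[simp] theorem algebraMap_C (r : ℂ) : algebraMap T (R lam) (C r) = toR lam (C r) :=
  aeval_C ..

/-- `R` as a quadratic extension of `T`. -/
abbrev Quad : Type := QuadOrder (tu lam) tw ty tz

/-- The map `S → T[ω]` that sends `x` to `ω`. -/
noncomputable def toQuad : S →ₐ[ℂ] Quad lam :=
  aeval ![algebraMap T _ tw, QuadraticAlgebra.omega, algebraMap T _ ty, algebraMap T _ tz]

theorem toQuad_w : toQuad lam w = algebraMap T _ tw := aeval_X ..

theorem toQuad_x : toQuad lam x = QuadraticAlgebra.omega := aeval_X ..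

theorem toQuad_y : toQuad lam y = algebraMap T _ ty := aeval_X ..

theorem toQuad_z : toQuad lam z = algebraMap T _ tz := aeval_X ..

theorem toQuad_C (r : ℂ) : toQuad lam (C r) = algebraMap T _ (C r) := aeval_C ..

theorem toQuad_f : toQuad lam (f lam) = 0 := by
  have h_omega : (QuadraticAlgebra.omega : Quad lam) ^ 2 =
      algebraMap T _ (xiSq (tu lam) tw ty tz) := by
    ext <;> simp [pow_two]
  have h_xiSq : xiSq (tu lam) tw ty tz + ty ^ 3 + tw * tz ^ 2 + tw ^ 3 * ty -
      C lam * tw * ty ^ 2 - C lam * tw ^ 4 = 0 := by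
    rw [xiSq]
    ring
  have := congrArg (algebraMap T (Quad lam)) h_xiSq
  simpa only [f, map_add, map_sub, map_mul, map_pow, map_zero, toQuad_w, toQuad_x, toQuad_y,
    toQuad_z, toQuad_C, h_omega] using this

theorem toR_x_mul_toR_x :
    toR lam x * toR lam x = xiSq (tu lam) tw ty tz • 1 + (0 : T) • toR lam x := by
  have h : toR lam (f lam) = 0 :=
    Ideal.Quotient.eq_zero_iff_mem.mpr (Ideal.mem_span_singleton_self _)
  simp only [f, map_add, map_sub, map_mul, map_pow] at h
  simp only [xiSq, Algebra.smul_def, map_add, map_sub, map_mul, map_pow, map_neg, algebraMap_tz,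
    algebraMap_tw, algebraMap_ty, algebraMap_C, map_zero]
  linear_combination h

/-- The map `T[ω] → R` that sends `ω` to `x`. -/
noncomputable def ofQuadR : Quad lam →ₐ[T] R lam :=
  QuadraticAlgebra.lift ⟨toR lam x, toR_x_mul_toR_x lam⟩

theorem ofQuadR_omega : ofQuadR lam QuadraticAlgebra.omega = toR lam x :=
  congrArg Subtype.val (QuadraticAlgebra.lift.symm_apply_apply _)

theorem ofQuadR_toQuad (p : S) : ofQuadR lam (toQuad lam p) = toR lam p := by
  suffices ((ofQuadR lam).restrictScalars ℂ).comp (toQuad lam) = toR lam from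
    AlgHom.congr_fun this p
  refine MvPolynomial.algHom_ext fun n => ?_
  fin_cases n
  · exact (congrArg (ofQuadR lam) (toQuad_w lam)).trans
      (((ofQuadR lam).commutes tw).trans (algebraMap_tw lam))
  · exact (congrArg (ofQuadR lam) (toQuad_x lam)).trans (ofQuadR_omega lam)
  · exact (congrArg (ofQuadR lam) (toQuad_y lam)).trans
      (((ofQuadR lam).commutes ty).trans (algebraMap_ty lam))
  · exact (congrArg (ofQuadR lam) (toQuad_z lam)).trans
      (((ofQuadR lam).commutes tz).trans (algebraMap_tz lam))

/-- The map `R → T[ω]` that sends `x` to `ω`. -/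
noncomputable def quadOfR : R lam →ₐ[ℂ] Quad lam :=
  Ideal.Quotient.liftₐ _ (toQuad lam) fun p hp => by
    obtain ⟨q, rfl⟩ := Ideal.mem_span_singleton'.mp hp
    rw [map_mul, toQuad_f, mul_zero]

theorem quadOfR_toR (p : S) : quadOfR lam (toR lam p) = toQuad lam p := rfl

theorem quadOfR_algebraMap (t : T) : quadOfR lam (algebraMap T (R lam) t) = algebraMap T _ t := by
  suffices (quadOfR lam).comp (IsScalarTower.toAlgHom ℂ T (R lam)) =
      IsScalarTower.toAlgHom ℂ T (Quad lam) from AlgHom.congr_fun this t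
  refine MvPolynomial.algHom_ext fun n => ?_
  fin_cases n
  · exact (congrArg _ (algebraMap_tz lam)).trans (toQuad_z lam)
  · exact (congrArg _ (algebraMap_tw lam)).trans (toQuad_w lam)
  · exact (congrArg _ (algebraMap_ty lam)).trans (toQuad_y lam)

/-- `R` is the quadratic extension `T[ω]` of `T`. -/
noncomputable def quadEquiv : Quad lam ≃ₐ[T] R lam :=
  AlgEquiv.ofAlgHom (ofQuadR lam)
    { quadOfR lam with commutes' := quadOfR_algebraMap lam }
    (AlgHom.ext fun r => by
      obtain ⟨p, rfl⟩ := Ideal.Quotient.mk_surjective r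
      exact ofQuadR_toQuad lam p)
    (QuadraticAlgebra.algHom_ext (by
      change quadOfR lam (ofQuadR lam QuadraticAlgebra.omega) = QuadraticAlgebra.omega
      rw [ofQuadR_omega, quadOfR_toR, toQuad_x]))

theorem quadEquiv_omega : quadEquiv lam QuadraticAlgebra.omega = toR lam x :=
  ofQuadR_omega lam

theorem quadEquiv_symm_toR (p : S) : (quadEquiv lam).symm (toR lam p) = toQuad lam p := rfl

end MorrisonPinkham

namespace MorrisonPinkham

open QuatOrder QuiverRep

variable (lam : ℂ)

noncomputable instance : Module T (M lam) := Module.compHom (M lam) (algebraMap T (R lam))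

noncomputable instance : SMul T (M lam) := Module.toDistribMulAction.toSMul

instance : IsScalarTower T (R lam) (M lam) := .of_algebraMap_smul fun _ _ => rfl

/-- The classes in `M` of the standard basis vectors. -/
noncomputable def basisM (i : Fin 4) : M lam := Submodule.Quotient.mk (Pi.single i 1)

theorem mk_eq_sum (v : Fin 4 → R lam) :
    (Submodule.Quotient.mk v : M lam) = ∑ i, v i • basisM lam i := by
  conv_lhs => rw [pi_eq_sum_univ' v]
  simp only [← Submodule.mkQ_apply, map_sum, map_smul]
  rfl

theorem matMap_apply {m n : ℕ} (A : Matrix (Fin m) (Fin n) S) (v : Fin n → R lam)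
    (i : Fin m) : matMap lam A v i = ∑ j, toR lam (A i j) * v j :=
  rfl

theorem matMap_single {m n : ℕ} (A : Matrix (Fin m) (Fin n) S) (j : Fin n) (i : Fin m) :
    matMap lam A (Pi.single j 1) i = toR lam (A i j) := by
  simp [matMap_apply, Pi.single_apply]

theorem mk_matMap_single {n : ℕ} (A : Matrix (Fin 4) (Fin n) S) (j : Fin n) :
    (Submodule.Quotient.mk (matMap lam A (Pi.single j 1)) : M lam) =
      ∑ i, toR lam (A i j) • basisM lam i := by
  simp only [mk_eq_sum, matMap_single]

theorem sum_Psi_smul_basisM (j : Fin 4) :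
    ∑ i, toR lam (Psi lam i j) • basisM lam i = 0 := by
  rw [← mk_matMap_single]
  exact (Submodule.Quotient.mk_eq_zero _).mpr ⟨_, rfl⟩

theorem loopA_basisM (j : Fin 4) :
    loopA lam (basisM lam j) = ∑ i, toR lam (matA lam i j) • basisM lam i :=
  mk_matMap_single lam (matA lam) j

theorem loopB_basisM (j : Fin 4) :
    loopB lam (basisM lam j) = ∑ i, toR lam (matB i j) • basisM lam i :=
  mk_matMap_single lam matB j

theorem mapC_basisM (j : Fin 4) : mapC lam (basisM lam j) = toR lam (Phi lam 0 j) :=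
  matMap_single lam (Phi lam) j 0

/-- The map `ℍ → M` from the quaternion order that turns left multiplication by `i` and `j` into
the loops `a` and `b`, and `1` into the class of the fourth standard basis vector. -/
noncomputable def quatToM : QuatOrder (tu lam) tw →ₗ[T] M lam where
  toFun h := h.re • basisM lam 3 + h.imI • basisM lam 2 - h.imJ • basisM lam 1 -
    h.imK • basisM lam 0
  map_add' h h' := by
    simp only [QuaternionAlgebra.re_add, QuaternionAlgebra.imI_add, QuaternionAlgebra.imJ_add,
      QuaternionAlgebra.imK_add]
    module
  map_smul' t h := by
    simp only [QuaternionAlgebra.re_smul, QuaternionAlgebra.imI_smul,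
      QuaternionAlgebra.imJ_smul, QuaternionAlgebra.imK_smul, smul_eq_mul, RingHom.id_apply]
    module

theorem quatToM_apply (h : QuatOrder (tu lam) tw) :
    quatToM lam h = algebraMap T (R lam) h.re • basisM lam 3 +
      algebraMap T (R lam) h.imI • basisM lam 2 - algebraMap T (R lam) h.imJ • basisM lam 1 -
      algebraMap T (R lam) h.imK • basisM lam 0 := by
  simp only [algebraMap_smul]
  rfl

theorem quatToM_one : quatToM lam 1 = basisM lam 3 := by
  simp [quatToM_apply]
  module

theorem loopA_quatToM (h : QuatOrder (tu lam) tw) :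
    loopA lam (quatToM lam h) = quatToM lam (i * h) := by
  simp only [quatToM_apply, map_add, map_sub, map_smul, loopA_basisM, Fin.sum_univ_four]
  simp [matA, -Ideal.Quotient.mkₐ_eq_mk]
  module

theorem loopB_quatToM (h : QuatOrder (tu lam) tw) :
    loopB lam (quatToM lam h) = quatToM lam (j * h) := by
  simp only [quatToM_apply, map_add, map_sub, map_smul, loopB_basisM, Fin.sum_univ_four]
  simp [matB, -Ideal.Quotient.mkₐ_eq_mk]
  module

theorem quatToM_mul_xi (h : QuatOrder (tu lam) tw) :
    quatToM lam (h * xi ty tz) = toR lam x • quatToM lam h := by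
  have h₀ := sum_Psi_smul_basisM lam 0
  have h₁ := sum_Psi_smul_basisM lam 1
  have h₂ := sum_Psi_smul_basisM lam 2
  have h₃ := sum_Psi_smul_basisM lam 3
  simp only [Fin.sum_univ_four, Psi, Matrix.cons_val, Matrix.of_apply, map_neg, map_mul, map_sub,
    map_pow] at h₀ h₁ h₂ h₃
  simp only [quatToM_apply, QuaternionAlgebra.re_mul, QuaternionAlgebra.imI_mul,
    QuaternionAlgebra.imJ_mul, QuaternionAlgebra.imK_mul, re_xi, imI_xi, imJ_xi, imK_xi, map_neg,
    map_mul, map_sub, map_add, algebraMap_C, algebraMap_tw, algebraMap_ty, algebraMap_tz, map_zero]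
  linear_combination (norm := module) algebraMap T (R lam) h.imK • h₀ +
    algebraMap T (R lam) h.imJ • h₁ - algebraMap T (R lam) h.imI • h₂ -
    algebraMap T (R lam) h.re • h₃

theorem quadEquiv_apply (r : Quad lam) : quadEquiv lam r =
    algebraMap T (R lam) r.re + algebraMap T (R lam) r.im * toR lam x := by
  conv_lhs => rw [← QuadraticAlgebra.mk_eta r, QuadraticAlgebra.mk_eq_add_smul_omega]
  rw [map_add, map_smul, quadEquiv_omega, Algebra.smul_def]
  congr 1
  exact (quadEquiv lam).commutes r.re

theorem mapC_quatToM (h : QuatOrder (tu lam) tw) :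
    mapC lam (quatToM lam h) = quadEquiv lam (pairing ty tz h) := by
  simp only [quatToM_apply, quadEquiv_apply, re_pairing, im_pairing, map_add, map_sub, map_neg,
    map_mul, map_smul, mapC_basisM, Phi, Matrix.of_apply, Matrix.cons_val, algebraMap_tw,
    algebraMap_ty, algebraMap_tz, smul_eq_mul]
  ring

theorem quatToM_mul_ofQuad (h : QuatOrder (tu lam) tw) (r : Quad lam) :
    quatToM lam (h * ofQuad ty tz r) = quadEquiv lam r • quatToM lam h :=
  map_mul_ofQuad_of_map_mul_xi (ρ := (quadEquiv lam).toAlgHom)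
    (fun h => (quatToM_mul_xi lam h).trans (by rw [← quadEquiv_omega]; rfl)) h r

/-- The quaternions that correspond to the classes of the standard basis vectors. -/
noncomputable def basisQuat : Fin 4 → QuatOrder (tu lam) tw := ![-k, -j, i, 1]

theorem quatToM_basisQuat (n : Fin 4) : quatToM lam (basisQuat lam n) = basisM lam n := by
  fin_cases n <;> simp [basisQuat, quatToM_apply] <;> module

/-- The lift to `R⁴` of the inverse of `quatToM`. -/
noncomputable def toQuat : (Fin 4 → R lam) →+ QuatOrder (tu lam) tw where
  toFun v := ∑ n, basisQuat lam n * ofQuad ty tz ((quadEquiv lam).symm (v n))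
  map_zero' := by simp
  map_add' v v' := by simp [mul_add, Finset.sum_add_distrib]

theorem toQuat_apply (v : Fin 4 → R lam) :
    toQuat lam v = ∑ n, basisQuat lam n * ofQuad ty tz ((quadEquiv lam).symm (v n)) := rfl

theorem quatToM_toQuat (v : Fin 4 → R lam) :
    quatToM lam (toQuat lam v) = Submodule.Quotient.mk v := by
  simp only [toQuat_apply, map_sum, quatToM_mul_ofQuad, AlgEquiv.apply_symm_apply,
    quatToM_basisQuat, mk_eq_sum]

theorem sum_basisQuat_mul_Psi (n : Fin 4) :
    ∑ l, basisQuat lam l * ofQuad ty tz (toQuad lam (Psi lam l n)) = 0 := by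
  fin_cases n <;>
    simp only [Fin.sum_univ_four, basisQuat, Psi, Matrix.of_apply, Matrix.cons_val, map_neg,
      map_mul, map_sub, map_pow, toQuad_w, toQuad_x, toQuad_y, toQuad_z, toQuad_C, ofQuad_omega,
      map_pow, AlgHom.commutes, Fin.zero_eta, Fin.mk_one, Fin.reduceFinMk, Fin.isValue] <;>
    simp only [pow_two, Algebra.algebraMap_eq_smul_one] <;>
    ext1 <;> simp <;> ring

theorem toQuat_matMap_Psi (v : Fin 4 → R lam) : toQuat lam (matMap lam (Psi lam) v) = 0 := by
  simp only [toQuat_apply, matMap_apply, map_sum, map_mul, quadEquiv_symm_toR, Finset.mul_sum]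
  rw [Finset.sum_comm]
  refine Finset.sum_eq_zero fun n _ => ?_
  simp only [← mul_assoc, ← Finset.sum_mul, sum_basisQuat_mul_Psi, zero_mul]

theorem quatToM_injective : Function.Injective (quatToM lam) := by
  refine (injective_iff_map_eq_zero _).mpr fun h hh => ?_
  let v : Fin 4 → R lam := ![-algebraMap T _ h.imK, -algebraMap T _ h.imJ, algebraMap T _ h.imI,
    algebraMap T _ h.re]
  have hv : (Submodule.Quotient.mk v : M lam) = 0 := by
    rw [← hh, mk_eq_sum, quatToM_apply, Fin.sum_univ_four]
    simp only [v, Matrix.cons_val]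
    module
  obtain ⟨v', hv'⟩ := (Submodule.Quotient.mk_eq_zero _).mp hv
  have := toQuat_matMap_Psi lam v'
  rw [hv'] at this
  rw [← this]
  simp only [toQuat_apply, Fin.sum_univ_four, v, basisQuat, Matrix.cons_val, map_neg,
    Algebra.algebraMap_eq_smul_one]
  ext1 <;> simp

theorem quatToM_surjective : Function.Surjective (quatToM lam) := fun m => by
  obtain ⟨v, rfl⟩ := Submodule.Quotient.mk_surjective _ m
  exact ⟨_, quatToM_toQuat lam v⟩

/-- `M` is the quaternion order, as a module over `T`. -/
noncomputable def quatEquiv : QuatOrder (tu lam) tw ≃ₗ[T] M lam :=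
  LinearEquiv.ofBijective (quatToM lam) ⟨quatToM_injective lam, quatToM_surjective lam⟩

theorem isQuatModel :
    IsQuatModel (loopA lam) (loopB lam) (mapC lam) (mapD lam) (quadEquiv lam) (quatEquiv lam) where
  map_mul_xi h := (quatToM_mul_xi lam h).trans (by rw [← quadEquiv_omega]; rfl)
  a_map := loopA_quatToM lam
  b_map := loopB_quatToM lam
  c_map := mapC_quatToM lam
  d_one := (LinearMap.toSpanSingleton_apply_one ..).trans (quatToM_one lam).symm

end MorrisonPinkham

namespace QuiverRep

open MorrisonPinkham PathAlgebra

section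

variable {B : Type} [Ring B] (J : QuiverRep B)

/-- The images of the vertices under a representation. -/
def ofVertex : Vertex → B
  | .nodeR => J.eR
  | .nodeM => J.eM

/-- The images of the arrows under a representation. -/
def ofArrow : ∀ {i j : Vertex}, (i ⟶ j) → B
  | _, _, Arrow.d => J.d
  | _, _, Arrow.c => J.c
  | _, _, Arrow.a => J.a
  | _, _, Arrow.b => J.b

theorem completeOrthogonalIdempotents_ofVertex : CompleteOrthogonalIdempotents J.ofVertex where
  idem
    | .nodeR => J.eR_mul_eR
    | .nodeM => by simpa only [ofVertex, J.eM_eq] using IsIdempotentElem.one_sub J.eR_mul_eR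
  ortho
    | .nodeR, .nodeR, h | .nodeM, .nodeM, h => absurd rfl h
    | .nodeR, .nodeM, _ => J.eR_mul_eM
    | .nodeM, .nodeR, _ => by
      simp [ofVertex, J.eM_eq, sub_mul, J.eR_mul_eR]
  complete := (Finset.sum_pair (by simp)).trans J.eR_add_eM

theorem ofVertex_mul_ofArrow {i j : Vertex} (α : i ⟶ j) :
    J.ofVertex j * J.ofArrow α = J.ofArrow α := by
  change Arrow i j at α
  cases α
  exacts [J.eM_mul_d, J.eR_mul_c, J.eM_mul_a, J.eM_mul_b]

theorem ofArrow_mul_ofVertex {i j : Vertex} (α : i ⟶ j) :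
    J.ofArrow α * J.ofVertex i = J.ofArrow α := by
  change Arrow i j at α
  cases α
  exacts [J.d_mul_eR, J.c_mul_eM, J.a_mul_eM, J.b_mul_eM]

variable [Algebra ℂ B]

/-- The homomorphism out of the path algebra given by a representation. -/
noncomputable def pathHom : P →ₐ[ℂ] B :=
  liftAlgHom J.completeOrthogonalIdempotents_ofVertex J.ofVertex_mul_ofArrow

theorem pathHom_vertex (i : Vertex) : J.pathHom (vertex ℂ i) = J.ofVertex i :=
  liftAlgHom_vertex _ _ i

theorem pathHom_arrow {i j : Vertex} (α : i ⟶ j) : J.pathHom (arrow ℂ α) = J.ofArrow α :=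
  liftAlgHom_arrow _ _ α (J.ofArrow_mul_ofVertex α)

end

/-- The representation of the quiver in its path algebra. -/
noncomputable def taut : QuiverRep P where
  eR := MorrisonPinkham.eR
  eM := MorrisonPinkham.eM
  a := MorrisonPinkham.a
  b := MorrisonPinkham.b
  c := MorrisonPinkham.c
  d := MorrisonPinkham.d
  eR_add_eM := (Finset.sum_pair (f := vertex ℂ) (by simp)).symm
  eR_mul_eR := vertex_mul_vertex ℂ _
  a_mul_eR := ofPath_mul_ofPath_of_ne ℂ _ _ (by simp)
  eR_mul_a := ofPath_mul_ofPath_of_ne ℂ _ _ (by simp)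
  b_mul_eR := ofPath_mul_ofPath_of_ne ℂ _ _ (by simp)
  eR_mul_b := ofPath_mul_ofPath_of_ne ℂ _ _ (by simp)
  c_mul_eR := ofPath_mul_ofPath_of_ne ℂ _ _ (by simp)
  eR_mul_c := vertex_mul_arrow ℂ _
  d_mul_eR := arrow_mul_vertex ℂ _
  eR_mul_d := ofPath_mul_ofPath_of_ne ℂ _ _ (by simp)

theorem map_taut_pathHom {B : Type} [Ring B] [Algebra ℂ B] (J : QuiverRep B) :
    taut.map J.pathHom = J := by
  ext
  exacts [J.pathHom_vertex _, J.pathHom_vertex _, J.pathHom_arrow arrA, J.pathHom_arrow arrB,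
    J.pathHom_arrow arrC, J.pathHom_arrow arrD]

theorem adjoin_generators_taut : Algebra.adjoin ℂ taut.generators = ⊤ := by
  have hR : MorrisonPinkham.eR ∈ Algebra.adjoin ℂ taut.generators :=
    Algebra.subset_adjoin (.inl rfl)
  refine eq_top_of_vertex_mem_of_arrow_mem (fun i => ?_) fun {i j} α => ?_
  · cases i
    · exact hR
    · change taut.eM ∈ _
      rw [taut.eM_eq]
      exact sub_mem (one_mem _) hR
  · change Arrow i j at α
    refine Algebra.subset_adjoin ?_
    cases α
    exacts [.inr (.inr (.inr (.inr rfl))), .inr (.inr (.inr (.inl rfl))), .inr (.inl rfl),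
      .inr (.inr (.inl rfl))]

variable (lam : ℂ)

/-- The representation of the quiver in its path algebra modulo the relations. -/
noncomputable def quot : QuiverRep (A lam) :=
  taut.map (RingCon.mkₐ ℂ (relIdeal lam).ringCon)

theorem adjoin_generators_quot : Algebra.adjoin ℂ (quot lam).generators = ⊤ :=
  adjoin_generators_map adjoin_generators_taut (RingCon.mkₐ_surjective _)

theorem isPotential_quot : (quot lam).IsPotential lam where
  b_mul_b_mul_d := by
    have := toA_eq_zero lam (TwoSidedIdeal.subset_span (.inl rfl))
    rwa [pow_two, add_mul] at this
  c_mul_b_mul_b := by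
    have := toA_eq_zero lam (TwoSidedIdeal.subset_span (.inr (.inl rfl)))
    rwa [pow_two, mul_add, ← mul_assoc, ← mul_assoc] at this
  a_mul_b := toA_eq_zero lam (TwoSidedIdeal.subset_span (.inr (.inr (.inl rfl))))
  a_mul_a := by
    have := toA_eq_zero lam (TwoSidedIdeal.subset_span (.inr (.inr (.inr rfl))))
    rw [pow_three', pow_two, pow_two, Algebra.smul_def, ← mul_assoc] at this
    exact this

variable {lam} {B : Type} [Ring B] [Algebra ℂ B] {J : QuiverRep B}

theorem relIdeal_le_ker_pathHom (h : J.IsPotential lam) :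
    relIdeal lam ≤ TwoSidedIdeal.ker J.pathHom := by
  rw [relIdeal, TwoSidedIdeal.span_le]
  rintro p (rfl | rfl | rfl | rfl) <;>
    simp only [SetLike.mem_coe, TwoSidedIdeal.mem_ker, map_add, map_mul, map_smul, pow_succ,
      pow_zero, one_mul, MorrisonPinkham.a, MorrisonPinkham.b, MorrisonPinkham.c,
      MorrisonPinkham.d, pathHom_arrow, ofArrow]
  · rw [add_mul]
    exact h.b_mul_b_mul_d
  · rw [mul_add, ← mul_assoc, ← mul_assoc]
    exact h.c_mul_b_mul_b
  · exact h.a_mul_b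
  · rw [Algebra.smul_def, ← mul_assoc]
    exact h.a_mul_a

/-- The homomorphism out of the path algebra modulo the relations given by a representation that
satisfies the relations. -/
noncomputable def quotHom (h : J.IsPotential lam) : A lam →ₐ[ℂ] B :=
  RingCon.liftₐ (relIdeal lam).ringCon J.pathHom fun p q hpq => by
    have := relIdeal_le_ker_pathHom h ((TwoSidedIdeal.rel_iff _ _ _).mp hpq)
    rwa [TwoSidedIdeal.mem_ker, map_sub, sub_eq_zero] at this

theorem map_quot_quotHom (h : J.IsPotential lam) : (quot lam).map (quotHom h) = J :=
  map_taut_pathHom J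

end QuiverRep

namespace MorrisonPinkham

open QuiverRep

variable (lam : ℂ)

local instance : IsScalarTower ℂ (R lam) (M lam) := Submodule.Quotient.isScalarTower ..

/-- The representation of the quiver in `End_R(R ⊕ M)`. -/
noncomputable def endRep : QuiverRep (EndRM lam) :=
  ofMaps (loopA lam) (loopB lam) (mapC lam) (mapD lam)

theorem isPotential_endRep : (endRep lam).IsPotential lam :=
  (isQuatModel lam).isPotential

/-- The isomorphism of the path algebra modulo the relations with `End_R(R ⊕ M)`. -/
noncomputable def quotEquiv : A lam ≃ₐ[ℂ] EndRM lam :=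
  AlgEquiv.ofBijective (quotHom (isPotential_endRep lam)) <|
    (isQuatModel lam).bijective_of_map_eq (adjoin_generators_quot lam)
      (isPotential_quot lam) _ (map_quot_quotHom (isPotential_endRep lam))

theorem map_quot_quotEquiv : (quot lam).map (quotEquiv lam) = endRep lam :=
  map_quot_quotHom (isPotential_endRep lam)

end MorrisonPinkham

open MorrisonPinkham in
theorem theorem2 (lam : ℂ) :
    (Phi lam * Psi lam = f lam • (1 : Matrix (Fin 4) (Fin 4) S) ∧
      Psi lam * Phi lam = f lam • (1 : Matrix (Fin 4) (Fin 4) S)) ∧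
    (PathAlgebra.cycDeriv ℂ arrC (W lam) = (b ^ 2 + d * c) * d ∧
      PathAlgebra.cycDeriv ℂ arrD (W lam) = c * (b ^ 2 + d * c) ∧
      PathAlgebra.cycDeriv ℂ arrA (W lam) = a * b + b * a ∧
      PathAlgebra.cycDeriv ℂ arrB (W lam) =
        a ^ 2 + b * d * c + d * c * b + lam • b ^ 2 + b ^ 3) ∧
    ∃ Θ : A lam ≃ₐ[ℂ] EndRM lam,
      Θ (toA lam eR) = extRR lam LinearMap.id ∧
      Θ (toA lam eM) = extMM lam LinearMap.id ∧
      Θ (toA lam a) = extMM lam (loopA lam) ∧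
      Θ (toA lam b) = extMM lam (loopB lam) ∧
      Θ (toA lam c) = extMR lam (mapC lam) ∧
      Θ (toA lam d) = extRM lam (mapD lam) := by
  refine ⟨⟨Phi_mul_Psi lam, Psi_mul_Phi lam⟩, cycDeriv_W lam, quotEquiv lam, ?_⟩
  have h := map_quot_quotEquiv lam
  exact ⟨congrArg QuiverRep.eR h, congrArg QuiverRep.eM h, congrArg QuiverRep.a h,
    congrArg QuiverRep.b h, congrArg QuiverRep.c h, congrArg QuiverRep.d h⟩
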